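/- Let $\mathbb H$ be the upper half plane and $q=e^{2\pi i\tau}$ for $\tau\in\mathbb H$. For complex $a,x$ with $|x|<1$ put $(a;x)_\infty=\prod_{k\ge 0}(1-ax^k)$ and $(a_1,\dots,a_r;x)_\infty=\prod_j(a_j;x)_\infty$; let $\eta(\tau)=q^{1/24}(q;q)_\infty$ be the Dedekind eta function (with $q^{1/24}=e^{2\pi i\tau/24}$). For a prime $p$, an odd Dirichlet character $\chi$ modulo $p$, and the analytically continued Dirichlet $L$-function $L(s,\chi)$, let $$E_{1,\chi}(\tau)=1+\frac{2}{L(0,\chi)}\sum_{n=1}^\infty\chi(n)\frac{q^n}{1-q^n},\qquad \mathcal E_p(\tau)=\frac{2}{p-1}\sum_{\chi}E_{1,\chi}(\tau),$$ where the last sum is over the odd primitive Dirichlet characters $\chi$ modulo $p$. For $\gamma=\begin{pmatrix}\gamma_{11}&\gamma_{12}\\ \gamma_{21}&\gamma_{22}\end{pmatrix}\in SL(2,\mathbb Z)$ with $p\mid\gamma_{21}$, let $\langle\gamma\rangle(\mathcal E_p)(\tau)=(\gamma_{21}\tau+\gamma_{22})^{-1}\mathcal E_p(\gamma\tau)$.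 An equation $\langle a\rangle(\mathcal E_p)=F$ below means that $\langle\gamma\rangle(\mathcal E_p)=F$ on $\mathbb H$ for every such $\gamma$ with $\gamma_{22}\equiv a\pmod p$. For odd $k\geq 3$ and $1\le\ell\le (k-1)/2$ let $\varphi_{k,\ell}(\tau)=\theta\left[{(2\ell-1)/k\atop 1}\right](0,k\tau)$, where for real $\epsilon,\epsilon'$ $$\theta\left[{\epsilon\atop\epsilon'}\right](z,\tau)=\sum_{n\in\mathbb Z}\exp 2\pi i\left\{\tfrac12\left(n+\tfrac{\epsilon}{2}\right)^2\tau+\left(n+\tfrac{\epsilon}{2}\right)\left(z+\tfrac{\epsilon'}{2}\right)\right\},$$ and for integers $b_1,\dots,b_{(p-1)/2}$ let $$\mathfrak T_p[b_1,\dots,b_{(p-1)/2}](\tau)=\eta^3(p\tau)\prod_{k=1}^{(p-1)/2}\exp\left(-\frac{\pi i b_k(2k-1)}{2p}\right)\varphi_{p,k}(\tau)^{b_k}.$$ Then the following identities hold on $\mathbb H$. $p=5$: $$\langle 1\rangle(\mathcal E_{5})=\mathfrak T_{5}[2,-3]=\frac{(q;q)_\infty^2}{(q,q^{4};q^{5})_\infty^5}$$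 $$\langle 2\rangle(\mathcal E_{5})=\mathfrak T_{5}[-3,2]=q\,\frac{(q;q)_\infty^2}{(q^{2},q^{3};q^{5})_\infty^5}$$ $p=7$: $$\langle 1\rangle(\mathcal E_{7})=\mathfrak T_{7}[1,0,-2]=\frac{(q^{3},q^{4},q^{7},q^{7};q^{7})_\infty}{(q,q^{6};q^{7})_\infty^2}$$ $$\langle 2\rangle(\mathcal E_{7})=\mathfrak T_{7}[-2,1,0]=q\,\frac{(q^{2},q^{5},q^{7},q^{7};q^{7})_\infty}{(q^{3},q^{4};q^{7})_\infty^2}$$ $$\langle 3\rangle(\mathcal E_{7})=\mathfrak T_{7}[0,-2,1]=q\,\frac{(q,q^{6},q^{7},q^{7};q^{7})_\infty}{(q^{2},q^{5};q^{7})_\infty^2}$$ $p=11$: $$\langle 1\rangle(\mathcal E_{11})=\mathfrak T_{11}[0,1,0,-1,-1]=\frac{(q^{4},q^{7},q^{11},q^{11};q^{11})_\infty}{(q,q^{10},q^{2},q^{9};q^{11})_\infty}$$ $$\langle 2\rangle(\mathcal E_{11})=\mathfrak T_{11}[-1,0,0,1,-1]=q\,\frac{(q^{2},q^{9},q^{11},q^{11};q^{11})_\infty}{(q,q^{10},q^{5},q^{6};q^{11})_\infty}$$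 $$\langle 3\rangle(\mathcal E_{11})=\mathfrak T_{11}[1,-1,-1,0,0]=q\,\frac{(q^{5},q^{6},q^{11},q^{11};q^{11})_\infty}{(q^{3},q^{8},q^{4},q^{7};q^{11})_\infty}$$ $$\langle 5\rangle(\mathcal E_{11})=\mathfrak T_{11}[0,-1,1,-1,0]=q\,\frac{(q^{3},q^{8},q^{11},q^{11};q^{11})_\infty}{(q^{2},q^{9},q^{4},q^{7};q^{11})_\infty}$$ $$\langle 7\rangle(\mathcal E_{11})=\mathfrak T_{11}[-1,0,-1,0,1]=q^{2}\,\frac{(q,q^{10},q^{11},q^{11};q^{11})_\infty}{(q^{3},q^{8},q^{5},q^{6};q^{11})_\infty}$$ $p=13$: $$\langle 1\rangle(\mathcal E_{13})=\mathfrak T_{13}[1,0,0,-1,0,-1]=\frac{(q^{6},q^{7},q^{13},q^{13};q^{13})_\infty}{(q,q^{12},q^{3},q^{10};q^{13})_\infty}$$ $$\langle 2\rangle(\mathcal E_{13})=\mathfrak T_{13}[-1,-1,0,1,0,0]=q^{2}\,\frac{(q^{3},q^{10},q^{13},q^{13};q^{13})_\infty}{(q^{5},q^{8},q^{6},q^{7};q^{13})_\infty}$$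 $$\langle 3\rangle(\mathcal E_{13})=\mathfrak T_{13}[0,0,-1,0,1,-1]=q\,\frac{(q^{2},q^{11},q^{13},q^{13};q^{13})_\infty}{(q,q^{12},q^{4},q^{9};q^{13})_\infty}$$ $$\langle 4\rangle(\mathcal E_{13})=\mathfrak T_{13}[0,1,-1,-1,0,0]=q\,\frac{(q^{5},q^{8},q^{13},q^{13};q^{13})_\infty}{(q^{3},q^{10},q^{4},q^{9};q^{13})_\infty}$$ $$\langle 5\rangle(\mathcal E_{13})=\mathfrak T_{13}[0,-1,1,0,-1,0]=q\,\frac{(q^{4},q^{9},q^{13},q^{13};q^{13})_\infty}{(q^{2},q^{11},q^{5},q^{8};q^{13})_\infty}$$ $$\langle 7\rangle(\mathcal E_{13})=\mathfrak T_{13}[-1,0,0,0,-1,1]=q^{2}\,\frac{(q,q^{12},q^{13},q^{13};q^{13})_\infty}{(q^{2},q^{11},q^{6},q^{7};q^{13})_\infty}$$ $p=17$: $$\langle 1\rangle(\mathcal E_{17})=\mathfrak T_{17}[1,0,0,0,0,-1,-1,0]=\frac{(q^{8},q^{9},q^{17},q^{17};q^{17})_\infty}{(q^{2},q^{15},q^{3},q^{14};q^{17})_\infty}$$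 $$\langle 2\rangle(\mathcal E_{17})=\mathfrak T_{17}[0,-1,0,0,1,0,0,-1]=q\,\frac{(q^{4},q^{13},q^{17},q^{17};q^{17})_\infty}{(q,q^{16},q^{7},q^{10};q^{17})_\infty}$$ $$\langle 3\rangle(\mathcal E_{17})=\mathfrak T_{17}[0,0,0,-1,0,1,0,-1]=q\,\frac{(q^{3},q^{14},q^{17},q^{17};q^{17})_\infty}{(q,q^{16},q^{5},q^{12};q^{17})_\infty}$$ $$\langle 5\rangle(\mathcal E_{17})=\mathfrak T_{17}[0,0,0,1,-1,-1,0,0]=q\,\frac{(q^{5},q^{12},q^{17},q^{17};q^{17})_\infty}{(q^{3},q^{14},q^{4},q^{13};q^{17})_\infty}$$ $$\langle 7\rangle(\mathcal E_{17})=\mathfrak T_{17}[0,-1,1,0,0,0,-1,0]=q\,\frac{(q^{6},q^{11},q^{17},q^{17};q^{17})_\infty}{(q^{2},q^{15},q^{7},q^{10};q^{17})_\infty}$$ $$\langle 8\rangle(\mathcal E_{17})=\mathfrak T_{17}[0,0,-1,0,-1,0,0,1]=q^{3}\,\frac{(q,q^{16},q^{17},q^{17};q^{17})_\infty}{(q^{4},q^{13},q^{6},q^{11};q^{17})_\infty}$$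 $$\langle 11\rangle(\mathcal E_{17})=\mathfrak T_{17}[-1,1,-1,0,0,0,0,0]=q^{2}\,\frac{(q^{7},q^{10},q^{17},q^{17};q^{17})_\infty}{(q^{6},q^{11},q^{8},q^{9};q^{17})_\infty}$$ $$\langle 13\rangle(\mathcal E_{17})=\mathfrak T_{17}[-1,0,0,-1,0,0,1,0]=q^{3}\,\frac{(q^{2},q^{15},q^{17},q^{17};q^{17})_\infty}{(q^{5},q^{12},q^{8},q^{9};q^{17})_\infty}$$ $p=19$: $$\langle 1\rangle(\mathcal E_{19})=\mathfrak T_{19}[1,1,0,0,-1,-1,-1,0,0]=\frac{(q^{8},q^{11},q^{9},q^{10},q^{19},q^{19};q^{19})_\infty}{(q^{3},q^{16},q^{4},q^{15},q^{5},q^{14};q^{19})_\infty}$$ $$\langle 2\rangle(\mathcal E_{19})=\mathfrak T_{19}[0,-1,-1,0,1,1,0,-1,0]=q^{2}\,\frac{(q^{4},q^{15},q^{5},q^{14},q^{19},q^{19};q^{19})_\infty}{(q^{2},q^{17},q^{7},q^{12},q^{8},q^{11};q^{19})_\infty}$$ $$\langle 3\rangle(\mathcal E_{19})=\mathfrak T_{19}[1,-1,0,0,-1,0,1,0,-1]=q\,\frac{(q^{3},q^{16},q^{9},q^{10},q^{19},q^{19};q^{19})_\infty}{(q,q^{18},q^{5},q^{14},q^{8},q^{11};q^{19})_\infty}$$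 $$\langle 4\rangle(\mathcal E_{19})=\mathfrak T_{19}[0,0,1,-1,0,-1,0,1,-1]=q\,\frac{(q^{2},q^{17},q^{7},q^{12},q^{19},q^{19};q^{19})_\infty}{(q,q^{18},q^{4},q^{15},q^{6},q^{13};q^{19})_\infty}$$ $$\langle 5\rangle(\mathcal E_{19})=\mathfrak T_{19}[0,0,-1,1,0,0,-1,1,-1]=q\,\frac{(q^{2},q^{17},q^{6},q^{13},q^{19},q^{19};q^{19})_\infty}{(q,q^{18},q^{3},q^{16},q^{7},q^{12};q^{19})_\infty}$$ $$\langle 7\rangle(\mathcal E_{19})=\mathfrak T_{19}[0,0,1,-1,-1,1,0,-1,0]=q\,\frac{(q^{4},q^{15},q^{7},q^{12},q^{19},q^{19};q^{19})_\infty}{(q^{2},q^{17},q^{5},q^{14},q^{6},q^{13};q^{19})_\infty}$$ $$\langle 9\rangle(\mathcal E_{19})=\mathfrak T_{19}[-1,-1,0,-1,0,0,1,0,1]=q^{5}\,\frac{(q,q^{18},q^{3},q^{16},q^{19},q^{19};q^{19})_\infty}{(q^{6},q^{13},q^{8},q^{11},q^{9},q^{10};q^{19})_\infty}$$ $$\langle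 11\rangle(\mathcal E_{19})=\mathfrak T_{19}[-1,0,0,1,0,0,-1,-1,1]=q^{2}\,\frac{(q,q^{18},q^{6},q^{13},q^{19},q^{19};q^{19})_\infty}{(q^{2},q^{17},q^{3},q^{16},q^{9},q^{10};q^{19})_\infty}$$ $$\langle 13\rangle(\mathcal E_{19})=\mathfrak T_{19}[-1,1,-1,0,1,-1,0,0,0]=q^{2}\,\frac{(q^{5},q^{14},q^{8},q^{11},q^{19},q^{19};q^{19})_\infty}{(q^{4},q^{15},q^{7},q^{12},q^{9},q^{10};q^{19})_\infty}$$ -/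

import Mathlib

open Complex UpperHalfPlane CongruenceSubgroup
open scoped MatrixGroups Real

noncomputable section

namespace EisensteinTheta

/-- The nome `q = e^{2πiτ}`. -/
def nome (τ : ℍ) : ℂ := cexp (2 * π * Complex.I * (τ : ℂ))

/-- The weight `k ≥ 1` Hecke Eisenstein series
`E_{k,χ}(τ) = 1 + 2 / L(1 - k, χ) * ∑_{n ≥ 1} χ(n) n^{k-1} q^n / (1 - q^n)`, where
`DirichletCharacter.LFunction` is the analytically continued Dirichlet `L`-function. -/
def eisensteinChar {p : ℕ} [NeZero p] (k : ℕ) (χ : DirichletCharacter ℂ p) (τ : ℍ) : ℂ :=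
  1 + 2 / DirichletCharacter.LFunction χ (1 - (k : ℂ)) *
    ∑' n : ℕ+, χ ((n : ℕ) : ZMod p) *
      (((n : ℕ) : ℂ) ^ (k - 1) * nome τ ^ (n : ℕ) / (1 - nome τ ^ (n : ℕ)))

open Classical in
/-- `𝓔_p = 2/(p-1) * ∑ E_{1,χ}`, summed over the odd primitive Dirichlet characters mod `p`. -/
def eisensteinSum (p : ℕ) [NeZero p] (τ : ℍ) : ℂ :=
  2 / ((p : ℂ) - 1) *
    ∑ χ : DirichletCharacter ℂ p with χ.Odd ∧ χ.IsPrimitive, eisensteinChar 1 χ τ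

/-- The weight `k` operator `⟨γ⟩(f)(τ) = (γ₂₁ τ + γ₂₂)^{-k} f(γ τ)`. -/
def diamond (k : ℤ) (γ : SL(2, ℤ)) (f : ℍ → ℂ) (τ : ℍ) : ℂ :=
  (((γ 1 0 : ℤ) : ℂ) * (τ : ℂ) + ((γ 1 1 : ℤ) : ℂ)) ^ (-k) * f (γ • τ)

/-- `⟨a⟩(𝓔_p) = F`: for every `γ ∈ Γ₀(p)` whose lower right entry is congruent to `a` modulo `p`,
the function `⟨γ⟩(𝓔_p)` (weight one) equals `F`. -/
def DiamondEq (p : ℕ) [NeZero p] (a : ℕ) (F : ℍ → ℂ) : Prop :=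
  ∀ γ ∈ Gamma0 p, ((γ 1 1 : ℤ) : ZMod p) = (a : ZMod p) →
    diamond 1 γ (eisensteinSum p) = F

/-- The theta function with characteristic `[ε, ε']`. -/
def thetaChar (ε ε' : ℝ) (z τ : ℂ) : ℂ :=
  ∑' n : ℤ, cexp (2 * π * Complex.I *
    (1 / 2 * ((n : ℂ) + ε / 2) ^ 2 * τ + ((n : ℂ) + ε / 2) * (z + ε' / 2)))

/-- The theta constant `φ_{k,ℓ}(τ) = θ[(2ℓ-1)/k, 1](0, kτ)` of order `k` and index `ℓ`. -/
def phi (k ℓ : ℕ) (τ : ℍ) : ℂ :=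
  thetaChar ((2 * (ℓ : ℝ) - 1) / k) 1 0 ((k : ℂ) * (τ : ℂ))

/-- The theta quotient `𝔗_p[b₁, …, b_m](τ) = η³(pτ) ∏_k exp(-π i b_k (2k-1) / (2p)) φ_{p,k}(τ)^{b_k}`,
with `m = (p-1)/2`. The entry `b_k` is `b j` with `j = k - 1`. -/
def thetaQuot (p : ℕ) (b : Fin ((p - 1) / 2) → ℤ) (τ : ℍ) : ℂ :=
  ModularForm.eta ((p : ℂ) * (τ : ℂ)) ^ 3 *
    ∏ j : Fin ((p - 1) / 2),
      (cexp (-(π * Complex.I * (b j : ℂ) * (2 * ((j : ℕ) + 1 : ℂ) - 1) / (2 * (p : ℂ)))) *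
        phi p ((j : ℕ) + 1) τ ^ b j)

/-- `(a; x)_∞ = ∏_{k ≥ 0} (1 - a x^k)`. -/
def pochInf (a x : ℂ) : ℂ := ∏' k : ℕ, (1 - a * x ^ k)

/-- `qPoch N [r₁, …, r_m] τ` is the product `(q^{r₁}, …, q^{r_m}; q^N)_∞` with `q = e^{2πiτ}`. -/
def qPoch (N : ℕ) (r : List ℕ) (τ : ℍ) : ℂ :=
  (r.map fun s => pochInf (nome τ ^ s) (nome τ ^ N)).prod

end EisensteinTheta

end

open EisensteinTheta

/-!
Let `β(j) = 1/2 - j/p` for `0 < j < p`. The series `eisensteinPart p j`, with constant term `β(j)`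
and terms `± q^n / (1 - q^n)` for `n ≡ ± j` modulo `p`, is odd in the residue class `j`, and up to a
constant it is Hecke's weight one form `ζ(z) - r η(τ') - s η(1)` at `z = -jτ`, `τ' = pτ`, where `ζ`
is the Weierstrass zeta function, `η` its quasi-periods and `z = rτ' + s`; that is, it is a corrected
logarithmic derivative of the odd theta function. The forms attached to all division
points are permuted by `SL(2, ℤ)` (`heckeZ_smul`), so `⟨γ⟩` multiplies the index `j` by `γ₁₁`
(`eisensteinPart_smul`).

Since `L(0, χ) = ∑ χ(j) β(j)` (`LFunction_zero`), the average `𝓔_p` divides by the value at `χ` of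
the Stickelberger element `∑ β(c) [c]`. For `p = 5, 7, 11, 13, 17, 19` the inverse of that element
on odd characters is, up to normalization, a sum of only four group elements `[A]⁻¹`: the condition
is that `∑ᵢ β(c Aᵢ)` be `1` at `c = 1`, `-1` at `c = -1` and `0` elsewhere, a statement about least
residues that is decided by computation. Orthogonality of the odd characters then turns `𝓔_p` into
`∑ᵢ eisensteinPart p Aᵢ` (`eisensteinSum_eq`), and its diamond translates into sums of the same kind
(`diamond_eisensteinSum`).

In each case the four residues are of the form `b₁, b₂, b₃, -(b₁ + b₂ + b₃)` up to a common sign.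
The degenerate three-term relation for the odd theta function (`deriv_oddTheta_zero_mul`) says that
`Z(x) + Z(y) + Z(z) - Z(x + y + z)`, with `Z` the logarithmic derivative, is the single product
`θ'(0) θ(x + y) θ(y + z) θ(x + z) / (θ(x) θ(y) θ(z) θ(x + y + z))`. This explains why a sum of
Eisenstein series is a theta quotient. The Jacobi triple product (`jacobiTheta₂_eq_pochInf`) writes
all theta functions as `q`-products, and it remains to compare exponents (`thetaQuot_eq_qPoch`).
-/

noncomputable section

namespace EisensteinTheta

open Filter Topology Asymptotics

/-! ### The Jacobi triple product -/

lemma summable_norm_mul_pow (a : ℂ) {x : ℂ} (hx : ‖x‖ < 1) :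
    Summable fun k : ℕ ↦ ‖-(a * x ^ k)‖ := by
  simpa [norm_mul, norm_pow] using
    (summable_geometric_of_lt_one (norm_nonneg x) hx).mul_left ‖a‖

lemma multipliable_pochInf (a : ℂ) {x : ℂ} (hx : ‖x‖ < 1) :
    Multipliable fun k : ℕ ↦ 1 - a * x ^ k := by
  simpa [sub_eq_add_neg] using multipliable_one_add_of_summable (summable_norm_mul_pow a hx)

lemma pochInf_ne_zero {a x : ℂ} (hx : ‖x‖ < 1) (h : ∀ k : ℕ, 1 - a * x ^ k ≠ 0) :
    pochInf a x ≠ 0 := by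
  simpa [pochInf, sub_eq_add_neg] using tprod_one_add_ne_zero_of_summable
    (f := fun k ↦ -(a * x ^ k)) (fun k ↦ by simpa [sub_eq_add_neg] using h k)
    (summable_norm_mul_pow a hx)

lemma pochInf_ne_zero_of_norm_lt {a x : ℂ} (hx : ‖x‖ < 1) (ha : ‖a‖ < 1) :
    pochInf a x ≠ 0 := by
  refine pochInf_ne_zero hx fun k h ↦ ?_
  have h1 : ‖a * x ^ k‖ < 1 := by
    rw [norm_mul, norm_pow]
    exact mul_lt_one_of_nonneg_of_lt_one_left (norm_nonneg _) ha
      (pow_le_one₀ (norm_nonneg _) hx.le)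
  rw [← sub_eq_zero.mp h, norm_one] at h1
  exact lt_irrefl _ h1

lemma pochInf_eq_one_sub_mul (a : ℂ) {x : ℂ} (hx : ‖x‖ < 1) :
    pochInf a x = (1 - a) * pochInf (a * x) x := by
  have h (k : ℕ) : 1 - a * x ^ (k + 1) = 1 - a * x * x ^ k := by ring
  rw [pochInf, tprod_eq_zero_mul' (by simpa only [h] using multipliable_pochInf (a * x) hx)]
  simp [pochInf, h]

lemma multipliableLocallyUniformlyOn_pochInf {x : ℂ} (hx : ‖x‖ < 1) :
    MultipliableLocallyUniformlyOn (fun (k : ℕ) (a : ℂ) ↦ 1 - a * x ^ k) Set.univ := by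
  refine ⟨fun a ↦ pochInf a x, ?_⟩
  refine hasProdLocallyUniformlyOn_of_forall_compact isOpen_univ fun K _ hK ↦ ?_
  obtain ⟨C, hC⟩ := hK.isBounded.exists_norm_le
  simp_rw [pochInf, sub_eq_add_neg]
  refine Summable.hasProdUniformlyOn_nat_one_add hK
    ((summable_geometric_of_lt_one (norm_nonneg x) hx).mul_left C)
    (.of_forall fun n a ha ↦ ?_) fun _ ↦ by fun_prop
  rw [norm_neg, norm_mul, norm_pow]
  gcongr
  exact hC a ha

lemma differentiable_pochInf {x : ℂ} (hx : ‖x‖ < 1) :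
    Differentiable ℂ fun a ↦ pochInf a x := by
  have := (multipliableLocallyUniformlyOn_pochInf hx).hasProdLocallyUniformlyOn.differentiableOn
    (.of_forall fun _ ↦ by simpa [Finset.prod_fn] using
      DifferentiableOn.finsetProd (fun _ _ ↦ by fun_prop)) isOpen_univ
  exact differentiableOn_univ.mp this

lemma logDeriv_pochInf {a x : ℂ} (hx : ‖x‖ < 1) (h : ∀ k : ℕ, 1 - a * x ^ k ≠ 0) :
    logDeriv (fun a ↦ pochInf a x) a = ∑' k : ℕ, -(x ^ k / (1 - a * x ^ k)) := by
  have hl (k : ℕ) : logDeriv (fun a ↦ 1 - a * x ^ k) a = -(x ^ k / (1 - a * x ^ k)) := by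
    simp [logDeriv, neg_div]
  have hs : Summable fun k : ℕ ↦ -(x ^ k / (1 - a * x ^ k)) := by
    have h0 : Tendsto (fun k : ℕ ↦ a * x ^ k) atTop (𝓝 (a * 0)) :=
      (tendsto_pow_atTop_nhds_zero_of_norm_lt_one hx).const_mul a
    have h1 : Tendsto (fun k : ℕ ↦ (1 - a * x ^ k)⁻¹) cofinite (𝓝 (1 - a * 0)⁻¹) := by
      rw [Nat.cofinite_eq_atTop]
      exact (h0.const_sub 1).inv₀ (by simp)
    have h2 : Summable fun k : ℕ ↦ ‖x ^ k‖ := by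
      simpa [norm_pow] using summable_geometric_of_lt_one (norm_nonneg x) hx
    exact (h2.mul_tendsto_const h1).neg
  have := logDeriv_tprod_eq_tsum isOpen_univ (Set.mem_univ a)
    (f := fun k a ↦ 1 - a * x ^ k) h (fun _ ↦ by fun_prop) (by simpa only [hl] using hs)
    (multipliableLocallyUniformlyOn_pochInf hx) (pochInf_ne_zero hx h)
  rw [← tsum_congr hl, ← this]
  rfl


/-- The reciprocal `1 / (x; x)_m` of the finite Pochhammer symbol, extended by zero to `m < 0`. -/
def invPoch (x : ℂ) (m : ℤ) : ℂ :=
  if m < 0 then 0 else (∏ i ∈ Finset.range m.toNat, (1 - x * x ^ i))⁻¹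

lemma invPoch_of_neg (x : ℂ) {m : ℤ} (hm : m < 0) : invPoch x m = 0 := by simp [invPoch, hm]

lemma invPoch_natCast (x : ℂ) (m : ℕ) :
    invPoch x m = (∏ i ∈ Finset.range m, (1 - x * x ^ i))⁻¹ := by simp [invPoch]

lemma one_sub_mul_pow_ne_zero {x : ℂ} (hx : ‖x‖ < 1) (k : ℕ) : 1 - x * x ^ k ≠ 0 := by
  intro h
  have h1 : ‖x ^ (k + 1)‖ < 1 := by
    rw [norm_pow]; exact pow_lt_one₀ (norm_nonneg _) hx (by simp)
  rw [pow_succ', ← sub_eq_zero.mp h, norm_one] at h1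
  exact lt_irrefl _ h1

/-- The recursion `(1 - x ^ m) / (x; x)_m = 1 / (x; x)_{m-1}` holds for all integers `m`,
thanks to the vanishing of the left-hand factor at `m = 0`. -/
lemma invPoch_sub_one {x : ℂ} (hx : ‖x‖ < 1) (m : ℤ) :
    invPoch x (m - 1) = invPoch x m * (1 - x ^ m) := by
  rcases lt_or_ge m 0 with hm | hm
  · simp [invPoch_of_neg x hm, invPoch_of_neg x (show m - 1 < 0 by lia)]
  obtain ⟨n, rfl⟩ := Int.eq_ofNat_of_zero_le hm
  rcases n with _ | n
  · simp [invPoch]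
  · have : ((n + 1 : ℕ) : ℤ) - 1 = n := by simp
    rw [this, invPoch_natCast, invPoch_natCast, Finset.prod_range_succ, zpow_natCast, pow_succ',
      mul_inv, mul_assoc, inv_mul_cancel₀ (one_sub_mul_pow_ne_zero hx n), mul_one]

lemma tendsto_invPoch {x : ℂ} (hx : ‖x‖ < 1) :
    Tendsto (fun n : ℕ ↦ invPoch x n) atTop (𝓝 (pochInf x x)⁻¹) := by
  simp_rw [invPoch_natCast]
  exact ((multipliable_pochInf x hx).hasProd.tendsto_prod_nat).inv₀
    (pochInf_ne_zero hx (one_sub_mul_pow_ne_zero hx))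

lemma exists_norm_invPoch_le {x : ℂ} (hx : ‖x‖ < 1) : ∃ C, 0 ≤ C ∧ ∀ m : ℤ, ‖invPoch x m‖ ≤ C := by
  obtain ⟨C, hC⟩ := (Metric.isBounded_range_of_tendsto _ (tendsto_invPoch hx)).exists_norm_le
  have hC0 : 0 ≤ C := (norm_nonneg _).trans (hC _ ⟨0, rfl⟩)
  refine ⟨C, hC0, fun m ↦ ?_⟩
  rcases lt_or_ge m 0 with hm | hm
  · simpa [invPoch_of_neg x hm] using hC0
  · obtain ⟨n, rfl⟩ := Int.eq_ofNat_of_zero_le hm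
    exact hC _ ⟨n, rfl⟩

lemma tendsto_invPoch_add {x : ℂ} (hx : ‖x‖ < 1) (j : ℤ) :
    Tendsto (fun n : ℕ ↦ invPoch x (n + j)) atTop (𝓝 (pochInf x x)⁻¹) := by
  have h : Tendsto (fun n : ℕ ↦ ((n : ℤ) + j).toNat) atTop atTop := by
    rw [tendsto_atTop]
    intro b
    filter_upwards [eventually_ge_atTop (b + j.natAbs)] with n hn
    lia
  refine ((tendsto_invPoch hx).comp h).congr' ?_
  filter_upwards [eventually_ge_atTop j.natAbs] with n hn
  simp only [Function.comp_apply]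
  congr 1
  lia

/-- The polynomial form of the triple product: the `n`-th partial product, divided by
`(q²; q²)_{2n}`, is the theta series with its terms weighted by `q`-binomial factors. -/
lemma tsum_mul_invPoch_eq {q x : ℂ} (hq : ‖q‖ < 1) (hq0 : q ≠ 0) (hx : x ≠ 0)
    (hs : Summable fun j : ℤ ↦ ‖x ^ j * q ^ (j ^ 2)‖) (n : ℕ) :
    ∑' j : ℤ, x ^ j * q ^ (j ^ 2) * (invPoch (q ^ 2) (n - j) * invPoch (q ^ 2) (n + j)) =
      (∏ k ∈ Finset.range n, (1 - -(x * q) * (q ^ 2) ^ k)) *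
      (∏ k ∈ Finset.range n, (1 - -(x⁻¹ * q) * (q ^ 2) ^ k)) * invPoch (q ^ 2) (2 * n) := by
  have hQ : ‖q ^ 2‖ < 1 := by
    rw [norm_pow]; exact pow_lt_one₀ (norm_nonneg _) hq (by simp)
  induction n with
  | zero =>
    rw [tsum_eq_single 0]
    · simp [invPoch]
    · intro j hj
      rcases lt_or_gt_of_ne hj with h | h
      · rw [invPoch_of_neg _ (show ((0 : ℕ) : ℤ) + j < 0 by simpa using h)]; simp
      · rw [invPoch_of_neg _ (show ((0 : ℕ) : ℤ) - j < 0 by simpa using h)]; simp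
  | succ n ih =>
    obtain ⟨C, hC0, hC⟩ := exists_norm_invPoch_le hQ
    have hsum (n : ℕ) : Summable fun j : ℤ ↦ x ^ j * q ^ (j ^ 2) *
        (invPoch (q ^ 2) (n - j) * invPoch (q ^ 2) (n + j)) := by
      refine Summable.of_norm_bounded (hs.mul_right (C * C)) fun j ↦ ?_
      rw [norm_mul]
      refine mul_le_mul_of_nonneg_left ?_ (norm_nonneg _)
      rw [norm_mul]
      exact mul_le_mul (hC _) (hC _) (norm_nonneg _) hC0
    have hQ0 : q ^ 2 ≠ 0 := pow_ne_zero 2 hq0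
    have e1 : invPoch (q ^ 2) (2 * n) = invPoch (q ^ 2) (2 * (n + 1 : ℕ)) *
        ((1 - (q ^ 2) ^ (2 * n + 1)) * (1 - (q ^ 2) ^ (2 * n + 2))) := by
      rw [show (2 * n : ℤ) = (2 * (n + 1 : ℕ) - 1) - 1 by push_cast; ring, invPoch_sub_one hQ,
        invPoch_sub_one hQ, show (2 * (n + 1 : ℕ) - 1 : ℤ) = (2 * n + 1 : ℕ) by push_cast; ring,
        show (2 * (n + 1 : ℕ) : ℤ) = (2 * n + 2 : ℕ) by push_cast; ring, zpow_natCast, zpow_natCast]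
      ring
    have hne : (1 - (q ^ 2) ^ (2 * n + 1)) * (1 - (q ^ 2) ^ (2 * n + 2)) ≠ 0 := by
      have h := one_sub_mul_pow_ne_zero hQ
      simp only [← pow_succ'] at h
      exact mul_ne_zero (h _) (h _)
    refine mul_right_cancel₀ hne ?_
    rw [Finset.prod_range_succ, Finset.prod_range_succ, mul_assoc _ (invPoch _ _), ← e1]
    set f : ℤ → ℂ := fun j ↦ x ^ j * q ^ (j ^ 2) *
        (invPoch (q ^ 2) (n - j) * invPoch (q ^ 2) (n + j)) with hf
    trans (∑' j, f j) * ((1 - -(x * q) * (q ^ 2) ^ n) * (1 - -(x⁻¹ * q) * (q ^ 2) ^ n))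
    swap
    · rw [ih]; ring
    have s0 : Summable f := hsum n
    clear_value f
    have sA : Summable fun j ↦ f (j - 1) := (Equiv.subRight (1 : ℤ)).summable_iff.mpr s0
    have sB : Summable fun j ↦ f (j + 1) := (Equiv.addRight (1 : ℤ)).summable_iff.mpr s0
    have tA : ∑' j, f (j - 1) = ∑' j, f j := (Equiv.subRight (1 : ℤ)).tsum_eq f
    have tB : ∑' j, f (j + 1) = ∑' j, f j := (Equiv.addRight (1 : ℤ)).tsum_eq f
    have split : (1 - -(x * q) * (q ^ 2) ^ n) * (1 - -(x⁻¹ * q) * (q ^ 2) ^ n) =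
        (1 + (q ^ 2) ^ (2 * n + 1)) + x * q ^ (2 * n + 1) + x⁻¹ * q ^ (2 * n + 1) := by
      field_simp; ring
    have key : (∑' j : ℤ, x ^ j * q ^ (j ^ 2) * (invPoch (q ^ 2) ((n + 1 : ℕ) - j) *
        invPoch (q ^ 2) ((n + 1 : ℕ) + j))) *
        ((1 - (q ^ 2) ^ (2 * n + 1)) * (1 - (q ^ 2) ^ (2 * n + 2))) =
        (∑' j, f j) * (1 + (q ^ 2) ^ (2 * n + 1)) + (∑' j, f (j - 1)) * (x * q ^ (2 * n + 1)) +
          (∑' j, f (j + 1)) * (x⁻¹ * q ^ (2 * n + 1)) := by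
      rw [← tsum_mul_right, ← tsum_mul_right, ← tsum_mul_right, ← tsum_mul_right,
        ← (s0.mul_right _).tsum_add (sA.mul_right _),
        ← ((s0.mul_right _).add (sA.mul_right _)).tsum_add (sB.mul_right _)]
      refine tsum_congr fun j ↦ ?_
      have r1 : invPoch (q ^ 2) (n - j) =
          invPoch (q ^ 2) ((n + 1 : ℕ) - j) * (1 - (q ^ 2) ^ ((n + 1 : ℕ) - j : ℤ)) := by
        rw [← invPoch_sub_one hQ]; congr 1; push_cast; ring
      have r2 : invPoch (q ^ 2) (n + j) =
          invPoch (q ^ 2) ((n + 1 : ℕ) + j) * (1 - (q ^ 2) ^ ((n + 1 : ℕ) + j : ℤ)) := by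
        rw [← invPoch_sub_one hQ]; congr 1; push_cast; ring
      have r3 : invPoch (q ^ 2) (n - (j + 1)) =
          invPoch (q ^ 2) (n - j) * (1 - (q ^ 2) ^ ((n + 1 : ℕ) - j : ℤ) * (q ^ 2)⁻¹) := by
        rw [← zpow_sub_one₀ hQ0, show ((n + 1 : ℕ) - j - 1 : ℤ) = n - j by push_cast; ring,
          ← invPoch_sub_one hQ]
        congr 1; ring
      have r4 : invPoch (q ^ 2) (n + (j - 1)) =
          invPoch (q ^ 2) (n + j) * (1 - (q ^ 2) ^ ((n + 1 : ℕ) + j : ℤ) * (q ^ 2)⁻¹) := by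
        rw [← zpow_sub_one₀ hQ0, show ((n + 1 : ℕ) + j - 1 : ℤ) = n + j by push_cast; ring,
          ← invPoch_sub_one hQ]
        congr 1; ring
      have g1 : x ^ (j - 1) * q ^ ((j - 1) ^ 2) * (x * q ^ (2 * n + 1)) =
          x ^ j * q ^ (j ^ 2) * (q ^ 2) ^ ((n + 1 : ℕ) - j : ℤ) := by
        rw [zpow_sub_one₀ hx, ← zpow_natCast q 2, ← zpow_mul, ← zpow_natCast q (2 * n + 1),
          mul_assoc (x ^ j) (q ^ (j ^ 2)), ← zpow_add₀ hq0, show x ^ j * x⁻¹ * q ^ ((j - 1) ^ 2) *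
          (x * q ^ ((2 * n + 1 : ℕ) : ℤ)) = x ^ j * (q ^ ((j - 1) ^ 2) *
          q ^ ((2 * n + 1 : ℕ) : ℤ)) by field_simp, ← zpow_add₀ hq0]
        congr 2; push_cast; ring
      have g2 : x ^ (j + 1) * q ^ ((j + 1) ^ 2) * (x⁻¹ * q ^ (2 * n + 1)) =
          x ^ j * q ^ (j ^ 2) * (q ^ 2) ^ ((n + 1 : ℕ) + j : ℤ) := by
        rw [zpow_add_one₀ hx, ← zpow_natCast q 2, ← zpow_mul, ← zpow_natCast q (2 * n + 1),
          mul_assoc (x ^ j) (q ^ (j ^ 2)), ← zpow_add₀ hq0, show x ^ j * x * q ^ ((j + 1) ^ 2) *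
          (x⁻¹ * q ^ ((2 * n + 1 : ℕ) : ℤ)) = x ^ j * (q ^ ((j + 1) ^ 2) *
          q ^ ((2 * n + 1 : ℕ) : ℤ)) by field_simp, ← zpow_add₀ hq0]
        congr 2; push_cast; ring
      have uv : (q ^ 2) ^ (2 * n + 2) =
          (q ^ 2) ^ ((n + 1 : ℕ) - j : ℤ) * (q ^ 2) ^ ((n + 1 : ℕ) + j : ℤ) := by
        rw [← zpow_add₀ hQ0, ← zpow_natCast (q ^ 2)]; congr 1; push_cast; ring
      have uv' : (q ^ 2) ^ (2 * n + 1) = (q ^ 2) ^ ((n + 1 : ℕ) - j : ℤ) *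
          (q ^ 2) ^ ((n + 1 : ℕ) + j : ℤ) * (q ^ 2)⁻¹ := by
        rw [← uv, pow_succ _ (2 * n + 1), mul_inv_cancel_right₀ hQ0]
      have c1 : (n : ℤ) - (j - 1) = (n + 1 : ℕ) - j := by push_cast; ring
      have c2 : (n : ℤ) + (j + 1) = (n + 1 : ℕ) + j := by push_cast; ring
      simp only [hf, c1, c2, r3, r4]
      rw [r1, r2]
      set u := (q ^ 2) ^ ((n + 1 : ℕ) - j : ℤ)
      set v := (q ^ 2) ^ ((n + 1 : ℕ) + j : ℤ)
      set a := invPoch (q ^ 2) ((n + 1 : ℕ) - j)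
      set b := invPoch (q ^ 2) ((n + 1 : ℕ) + j)
      rw [uv, uv']
      linear_combination (-(a * b * (1 - v) * (1 - v * (q ^ 2)⁻¹))) * g1 +
        (-(a * b * (1 - u) * (1 - u * (q ^ 2)⁻¹))) * g2
    rw [key, tA, tB, split]
    ring

/-- **Jacobi triple product.** -/
theorem tsum_zpow_mul_zpow_sq {q x : ℂ} (hq : ‖q‖ < 1) (hq0 : q ≠ 0) (hx : x ≠ 0)
    (hs : Summable fun j : ℤ ↦ ‖x ^ j * q ^ (j ^ 2)‖) :
    ∑' j : ℤ, x ^ j * q ^ (j ^ 2) =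
      pochInf (q ^ 2) (q ^ 2) * pochInf (-(x * q)) (q ^ 2) * pochInf (-(x⁻¹ * q)) (q ^ 2) := by
  have hQ : ‖q ^ 2‖ < 1 := by
    rw [norm_pow]; exact pow_lt_one₀ (norm_nonneg _) hq (by simp)
  obtain ⟨C, hC0, hC⟩ := exists_norm_invPoch_le hQ
  have hP := pochInf_ne_zero hQ (one_sub_mul_pow_ne_zero hQ)
  have h1 : Tendsto (fun n : ℕ ↦ ∑' j : ℤ, x ^ j * q ^ (j ^ 2) *
      (invPoch (q ^ 2) (n - j) * invPoch (q ^ 2) (n + j))) atTop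
      (𝓝 (∑' j : ℤ, x ^ j * q ^ (j ^ 2) *
        ((pochInf (q ^ 2) (q ^ 2))⁻¹ * (pochInf (q ^ 2) (q ^ 2))⁻¹))) := by
    refine tendsto_tsum_of_dominated_convergence (hs.mul_right (C * C)) (fun j ↦ ?_)
      (.of_forall fun n j ↦ ?_)
    · refine tendsto_const_nhds.mul (Tendsto.mul ?_ (tendsto_invPoch_add hQ j))
      simpa only [sub_eq_add_neg] using tendsto_invPoch_add hQ (-j)
    · rw [norm_mul]
      refine mul_le_mul_of_nonneg_left ?_ (norm_nonneg _)
      rw [norm_mul]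
      exact mul_le_mul (hC _) (hC _) (norm_nonneg _) hC0
  simp_rw [tsum_mul_invPoch_eq hq hq0 hx hs] at h1
  have h2 : Tendsto (fun n : ℕ ↦ invPoch (q ^ 2) (2 * n)) atTop
      (𝓝 (pochInf (q ^ 2) (q ^ 2))⁻¹) := by
    have := (tendsto_invPoch hQ).comp (tendsto_id.const_mul_atTop' (show 0 < 2 by simp))
    refine this.congr fun n ↦ ?_
    simp
  have h3 := ((multipliable_pochInf (-(x * q)) hQ).hasProd.tendsto_prod_nat.mul
    (multipliable_pochInf (-(x⁻¹ * q)) hQ).hasProd.tendsto_prod_nat).mul h2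
  have h4 := tendsto_nhds_unique h1 h3
  rw [tsum_mul_right] at h4
  change _ = pochInf (-(x * q)) (q ^ 2) * pochInf (-(x⁻¹ * q)) (q ^ 2) * _ at h4
  generalize pochInf (-(x⁻¹ * q)) (q ^ 2) = B at h4 ⊢
  generalize pochInf (-(x * q)) (q ^ 2) = A at h4 ⊢
  field_simp at h4
  rw [h4]

lemma norm_cexp_lt_one {τ : ℂ} (hτ : 0 < τ.im) {c : ℝ} (hc : 0 < c) :
    ‖cexp (c * (π * Complex.I * τ))‖ < 1 := by
  rw [norm_exp, Real.exp_lt_one_iff]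
  have h : (c * (π * Complex.I * τ)).re = -(c * (π * τ.im)) := by simp
  rw [h, neg_lt_zero]
  have := Real.pi_pos
  positivity

/-- The Jacobi triple product for the two-variable theta function. -/
theorem jacobiTheta₂_eq_pochInf (z : ℂ) {τ : ℂ} (hτ : 0 < τ.im) :
    jacobiTheta₂ z τ = pochInf (cexp (2 * π * Complex.I * τ)) (cexp (2 * π * Complex.I * τ)) *
      pochInf (-cexp (2 * π * Complex.I * (z + τ / 2))) (cexp (2 * π * Complex.I * τ)) *
      pochInf (-cexp (2 * π * Complex.I * (-z + τ / 2))) (cexp (2 * π * Complex.I * τ)) := by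
  have hq : ‖cexp (π * Complex.I * τ)‖ < 1 := by simpa using norm_cexp_lt_one hτ one_pos
  have ht (j : ℤ) : jacobiTheta₂_term j z τ =
      cexp (2 * π * Complex.I * z) ^ j * cexp (π * Complex.I * τ) ^ (j ^ 2) := by
    rw [jacobiTheta₂_term, ← exp_int_mul, ← exp_int_mul, ← exp_add]
    congr 1; push_cast; ring
  have hs := ((summable_jacobiTheta₂_term_iff z τ).mpr hτ).norm
  simp_rw [ht] at hs
  rw [jacobiTheta₂, tsum_congr ht, tsum_zpow_mul_zpow_sq hq (exp_ne_zero _) (exp_ne_zero _) hs,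
    ← exp_nat_mul, ← exp_neg, ← exp_add, ← exp_add]
  have e0 : ((2 : ℕ) : ℂ) * (π * Complex.I * τ) = 2 * π * Complex.I * τ := by push_cast; ring
  have e1 : 2 * π * Complex.I * z + π * Complex.I * τ = 2 * π * Complex.I * (z + τ / 2) := by ring
  have e2 : -(2 * π * Complex.I * z) + π * Complex.I * τ = 2 * π * Complex.I * (-z + τ / 2) := by
    ring
  rw [e0, e1, e2]

/-! ### The odd theta function and its four-term relation -/

/-- The odd theta function
`e^{πiz} θ₃(z + (1 + τ) / 2) = ∑ (-1)^n e^{πi((2n + 1) z + (n² + n) τ)}`, that is, `θ₁(z, τ)` up to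
a factor depending on `τ` only. -/
def oddTheta (z τ : ℂ) : ℂ := cexp (π * Complex.I * z) * jacobiTheta₂ (z + (1 + τ) / 2) τ

lemma differentiable_oddTheta {τ : ℂ} (hτ : 0 < τ.im) : Differentiable ℂ (oddTheta · τ) := by
  intro z
  unfold oddTheta
  have h := (differentiableAt_jacobiTheta₂_fst (z + (1 + τ) / 2) hτ).comp z
    ((differentiableAt_id (𝕜 := ℂ)).add_const ((1 + τ) / 2))
  exact DifferentiableAt.mul (by fun_prop) h

lemma oddTheta_eq_pochInf (z : ℂ) {τ : ℂ} (hτ : 0 < τ.im) :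
    oddTheta z τ = pochInf (cexp (2 * π * Complex.I * τ)) (cexp (2 * π * Complex.I * τ)) *
      (cexp (π * Complex.I * z) *
        pochInf (cexp (2 * π * Complex.I * (z + τ))) (cexp (2 * π * Complex.I * τ)) *
        pochInf (cexp (2 * π * Complex.I * (-z))) (cexp (2 * π * Complex.I * τ))) := by
  have e1 : -cexp (2 * π * Complex.I * (z + (1 + τ) / 2 + τ / 2)) =
      cexp (2 * π * Complex.I * (z + τ)) := by
    rw [show 2 * π * Complex.I * (z + (1 + τ) / 2 + τ / 2) =
      2 * π * Complex.I * (z + τ) + π * Complex.I by ring, exp_add, exp_pi_mul_I]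
    ring
  have e2 : -cexp (2 * π * Complex.I * (-(z + (1 + τ) / 2) + τ / 2)) =
      cexp (2 * π * Complex.I * (-z)) := by
    rw [show 2 * π * Complex.I * (-(z + (1 + τ) / 2) + τ / 2) =
      2 * π * Complex.I * (-z) - π * Complex.I by ring, exp_sub, exp_pi_mul_I]
    ring
  rw [oddTheta, jacobiTheta₂_eq_pochInf _ hτ, e1, e2]
  ring

lemma norm_cexp_two_pi_I_mul_lt_one {τ : ℂ} (hτ : 0 < τ.im) :
    ‖cexp (2 * π * Complex.I * τ)‖ < 1 := by
  simpa [mul_assoc] using norm_cexp_lt_one hτ two_pos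

/-- The symmetric form of the product for the odd theta function, with the zero at the origin
split off. -/
lemma oddTheta_eq_sub_mul (z : ℂ) {τ : ℂ} (hτ : 0 < τ.im) :
    oddTheta z τ = (cexp (π * Complex.I * z) - cexp (-(π * Complex.I * z))) *
      (pochInf (cexp (2 * π * Complex.I * τ)) (cexp (2 * π * Complex.I * τ)) *
        pochInf (cexp (2 * π * Complex.I * (z + τ))) (cexp (2 * π * Complex.I * τ)) *
        pochInf (cexp (2 * π * Complex.I * (-z + τ))) (cexp (2 * π * Complex.I * τ))) := by
  rw [oddTheta_eq_pochInf z hτ, pochInf_eq_one_sub_mul (cexp (2 * π * Complex.I * (-z)))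
    (norm_cexp_two_pi_I_mul_lt_one hτ), ← exp_add, ← mul_add]
  have : cexp (π * Complex.I * z) * (1 - cexp (2 * π * Complex.I * (-z))) =
      cexp (π * Complex.I * z) - cexp (-(π * Complex.I * z)) := by
    rw [mul_sub, mul_one, ← exp_add]; congr 2; ring
  rw [← this]; ring

lemma oddTheta_neg (z : ℂ) {τ : ℂ} (hτ : 0 < τ.im) : oddTheta (-z) τ = -oddTheta z τ := by
  rw [oddTheta_eq_sub_mul _ hτ, oddTheta_eq_sub_mul _ hτ]
  simp only [mul_neg, neg_neg]
  ring

lemma oddTheta_zero {τ : ℂ} (hτ : 0 < τ.im) : oddTheta 0 τ = 0 := by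
  simp [oddTheta_eq_sub_mul _ hτ]

lemma deriv_oddTheta_neg (z : ℂ) {τ : ℂ} (hτ : 0 < τ.im) :
    deriv (oddTheta · τ) (-z) = deriv (oddTheta · τ) z := by
  have h := deriv_comp_neg (f := fun z ↦ oddTheta z τ) z
  simp_rw [oddTheta_neg _ hτ] at h
  rw [deriv.fun_neg] at h
  exact (neg_injective h).symm

/-- Jacobi's derivative formula. -/
lemma deriv_oddTheta_zero {τ : ℂ} (hτ : 0 < τ.im) :
    deriv (oddTheta · τ) 0 = 2 * π * Complex.I *
      pochInf (cexp (2 * π * Complex.I * τ)) (cexp (2 * π * Complex.I * τ)) ^ 3 := by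
  have hQ := norm_cexp_two_pi_I_mul_lt_one hτ
  have hd := differentiable_pochInf hQ
  have h1 : HasDerivAt (fun z ↦ cexp (π * Complex.I * z) - cexp (-(π * Complex.I * z)))
      (2 * π * Complex.I) 0 := by
    have h2 : HasDerivAt (fun z ↦ π * Complex.I * z) (π * Complex.I) 0 := by
      simpa using (hasDerivAt_id (0 : ℂ)).const_mul (π * Complex.I)
    have := h2.cexp.sub h2.neg.cexp
    refine this.congr_deriv ?_
    simp
    ring
  have h3 : DifferentiableAt ℂ (fun z ↦
      pochInf (cexp (2 * π * Complex.I * τ)) (cexp (2 * π * Complex.I * τ)) *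
        pochInf (cexp (2 * π * Complex.I * (z + τ))) (cexp (2 * π * Complex.I * τ)) *
        pochInf (cexp (2 * π * Complex.I * (-z + τ))) (cexp (2 * π * Complex.I * τ))) 0 := by
    have h4 : Differentiable ℂ fun z ↦ cexp (2 * π * Complex.I * (z + τ)) := by fun_prop
    have h5 : Differentiable ℂ fun z ↦ cexp (2 * π * Complex.I * (-z + τ)) := by fun_prop
    exact (((hd.comp h4).const_mul _).mul (hd.comp h5)) 0
  have h6 := h1.mul h3.hasDerivAt
  have h7 : (fun z ↦ oddTheta z τ) = _ := funext fun z ↦ oddTheta_eq_sub_mul z hτ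
  rw [h7]
  refine h6.deriv.trans ?_
  simp
  ring

/-- The addition formula: `θ(x + y) θ(x - y)` is an alternating form of rank two. -/
lemma oddTheta_add_mul_oddTheta_sub (x y : ℂ) {τ : ℂ} (hτ : 0 < τ.im) :
    oddTheta (x + y) τ * oddTheta (x - y) τ =
      cexp (2 * π * Complex.I * x) * jacobiTheta₂ (2 * x + τ) (2 * τ) *
        jacobiTheta₂ (2 * y) (2 * τ) -
      jacobiTheta₂ (2 * x) (2 * τ) *
        (cexp (2 * π * Complex.I * y) * jacobiTheta₂ (2 * y + τ) (2 * τ)) := by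
  have h2τ : 0 < (2 * τ).im := by simpa using hτ
  set t : ℂ → ℤ → ℂ := fun z n ↦
    cexp (π * Complex.I * z) * jacobiTheta₂_term n (z + (1 + τ) / 2) τ with ht
  have hs (z : ℂ) : Summable (t z) :=
    ((summable_jacobiTheta₂_term_iff _ τ).mpr hτ).mul_left _
  have hθ (z : ℂ) : ∑' n, t z n = oddTheta z τ := tsum_mul_left
  have hsP : Summable fun p : ℤ × ℤ ↦ t (x + y) p.1 * t (x - y) p.2 :=
    summable_mul_of_summable_norm (hs _).norm (hs _).norm
  have hP : HasSum (fun p : ℤ × ℤ ↦ t (x + y) p.1 * t (x - y) p.2)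
      (oddTheta (x + y) τ * oddTheta (x - y) τ) := by
    rw [← hθ, ← hθ, tsum_mul_tsum_of_summable_norm (hs _).norm (hs _).norm]
    exact hsP.hasSum
  -- `(m, n) = (k + l, k - l)` and `(k + l, k - l - 1)` exhaust the pairs of integers,
  -- according to the parity of `m - n`
  let e : (ℤ × ℤ) ⊕ (ℤ × ℤ) ≃ ℤ × ℤ := Equiv.ofBijective
    (Sum.elim (fun p ↦ (p.1 + p.2, p.1 - p.2)) (fun p ↦ (p.1 + p.2, p.1 - p.2 - 1))) <| by
    constructor
    · rintro (⟨a, b⟩ | ⟨a, b⟩) (⟨c, d⟩ | ⟨c, d⟩) h <;>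
        simp only [Sum.elim_inl, Sum.elim_inr, Prod.mk.injEq] at h <;>
        first
        | (exfalso; lia)
        | (congr 2 <;> lia)
    · rintro ⟨m, n⟩
      rcases Int.even_or_odd' (m - n) with ⟨c, hc | hc⟩
      · exact ⟨Sum.inl (m - c, c), by simp; lia⟩
      · exact ⟨Sum.inr (m - c, c), by simp; lia⟩
  have hA (z : ℂ) := hasSum_jacobiTheta₂_term z h2τ
  have hprod (z w : ℂ) : HasSum (fun p : ℤ × ℤ ↦ jacobiTheta₂_term p.1 z (2 * τ) *
      jacobiTheta₂_term p.2 w (2 * τ)) (jacobiTheta₂ z (2 * τ) * jacobiTheta₂ w (2 * τ)) := by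
    have := summable_mul_of_summable_norm (hA z).summable.norm (hA w).summable.norm
    rw [jacobiTheta₂, jacobiTheta₂,
      tsum_mul_tsum_of_summable_norm (hA z).summable.norm (hA w).summable.norm]
    exact this.hasSum
  have h1 := (hprod (2 * x + τ) (2 * y)).mul_left (cexp (2 * π * Complex.I * x))
  have h2 := (hprod (2 * x) (2 * y + τ)).mul_left (-cexp (2 * π * Complex.I * y))
  have c1 : (fun p : ℤ × ℤ ↦ cexp (2 * π * Complex.I * x) *
      (jacobiTheta₂_term p.1 (2 * x + τ) (2 * τ) * jacobiTheta₂_term p.2 (2 * y) (2 * τ))) =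
      ((fun p : ℤ × ℤ ↦ t (x + y) p.1 * t (x - y) p.2) ∘ e) ∘ Sum.inl := by
    ext ⟨k, l⟩
    change _ = t (x + y) (k + l) * t (x - y) (k - l)
    simp only [ht, jacobiTheta₂_term, ← exp_add]
    refine (exp_periodic.int_mul k _).symm.trans ?_
    congr 1
    push_cast
    ring
  have c2 : (fun p : ℤ × ℤ ↦ -cexp (2 * π * Complex.I * y) *
      (jacobiTheta₂_term p.1 (2 * x) (2 * τ) * jacobiTheta₂_term p.2 (2 * y + τ) (2 * τ))) =
      ((fun p : ℤ × ℤ ↦ t (x + y) p.1 * t (x - y) p.2) ∘ e) ∘ Sum.inr := by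
    ext ⟨k, l⟩
    change _ = t (x + y) (k + l) * t (x - y) (k - l - 1)
    have hneg : -cexp (2 * π * Complex.I * y) =
        cexp (2 * π * Complex.I * y + π * Complex.I) := by
      rw [exp_add, exp_pi_mul_I]; ring
    simp only [hneg, ht, jacobiTheta₂_term, ← exp_add]
    refine (exp_periodic.int_mul (k - 1) _).symm.trans ?_
    congr 1
    push_cast
    ring
  have h3 := HasSum.sum (f := (fun p : ℤ × ℤ ↦ t (x + y) p.1 * t (x - y) p.2) ∘ e)
    (c1 ▸ h1) (c2 ▸ h2)
  rw [hP.unique (e.hasSum_iff.mp h3)]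
  ring

/-- The degenerate form of Weierstrass' three-term relation, obtained by differentiating the
Plücker relation for the alternating form `θ(x + y) θ(x - y)` along the diagonal. Divided by
`θ(a) θ(b) θ(c) θ(a + b + c)`, it writes a sum of four logarithmic derivatives as a product. -/
theorem deriv_oddTheta_zero_mul (a b c : ℂ) {τ : ℂ} (hτ : 0 < τ.im) :
    deriv (oddTheta · τ) 0 * (oddTheta (a + b) τ * oddTheta (b + c) τ * oddTheta (a + c) τ) =
      deriv (oddTheta · τ) a * oddTheta b τ * oddTheta c τ * oddTheta (a + b + c) τ +
      oddTheta a τ * deriv (oddTheta · τ) b * oddTheta c τ * oddTheta (a + b + c) τ +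
      oddTheta a τ * oddTheta b τ * deriv (oddTheta · τ) c * oddTheta (a + b + c) τ -
      oddTheta a τ * oddTheta b τ * oddTheta c τ * deriv (oddTheta · τ) (a + b + c) := by
  set θ : ℂ → ℂ := (oddTheta · τ) with hθ
  have hd : Differentiable ℂ θ := differentiable_oddTheta hτ
  have hW (x y : ℂ) := oddTheta_add_mul_oddTheta_sub x y hτ
  -- the four points `a, b, -c, a + b + c` are written as `x ± v, x ± u`
  set x := (a + b) / 2 with hx
  set v := (a - b) / 2 with hv
  set u := x + c with hu
  have hpl (y : ℂ) : θ (x + y) * θ (x - y) * (θ (u + v) * θ (u - v)) -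
      θ (x + u) * θ (x - u) * (θ (y + v) * θ (y - v)) +
      θ (x + v) * θ (x - v) * (θ (y + u) * θ (y - u)) = 0 := by
    simp only [hθ, hW]
    ring
  have hadd (s : ℂ) : HasDerivAt (fun y ↦ θ (y + s)) (deriv θ (x + s)) x :=
    (hd (x + s)).hasDerivAt.comp_add_const x s
  have hsub (s : ℂ) : HasDerivAt (fun y ↦ θ (y - s)) (deriv θ (x - s)) x :=
    (hd (x - s)).hasDerivAt.comp_sub_const x s
  have hadd' : HasDerivAt (fun y ↦ θ (x + y)) (deriv θ (x + x)) x :=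
    (hd (x + x)).hasDerivAt.comp_const_add x x
  have hsub' : HasDerivAt (fun y ↦ θ (x - y)) (-deriv θ (x - x)) x :=
    (hd (x - x)).hasDerivAt.comp_const_sub x x
  have h := (((hadd'.mul hsub').mul_const (θ (u + v) * θ (u - v))).sub
    (((hadd v).mul (hsub v)).const_mul (θ (x + u) * θ (x - u)))).add
    (((hadd u).mul (hsub u)).const_mul (θ (x + v) * θ (x - v)))
  have h0 := h.unique ((hasDerivAt_const x (0 : ℂ)).congr_of_eventuallyEq (.of_forall hpl))
  have e1 : x + v = a := by rw [hx, hv]; ring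
  have e2 : x - v = b := by rw [hx, hv]; ring
  have e3 : x + u = a + b + c := by rw [hu, hx]; ring
  have e4 : x - u = -c := by rw [hu]; ring
  have e5 : u + v = a + c := by rw [hu, hx, hv]; ring
  have e6 : u - v = b + c := by rw [hu, hx, hv]; ring
  have e7 : x + x = a + b := by rw [hx]; ring
  have e8 : deriv θ (-c) = deriv θ c := deriv_oddTheta_neg c hτ
  have e9 : θ (-c) = -θ c := oddTheta_neg c hτ
  have e10 : θ 0 = 0 := oddTheta_zero hτ
  rw [e1, e2, e3, e4, e5, e6, e7, e8, e9, sub_self, e10] at h0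
  linear_combination -h0

lemma logDeriv_oddTheta_add_sub {a b c : ℂ} {τ : ℂ} (hτ : 0 < τ.im) (ha : oddTheta a τ ≠ 0)
    (hb : oddTheta b τ ≠ 0) (hc : oddTheta c τ ≠ 0) (hs : oddTheta (a + b + c) τ ≠ 0) :
    logDeriv (oddTheta · τ) a + logDeriv (oddTheta · τ) b + logDeriv (oddTheta · τ) c -
      logDeriv (oddTheta · τ) (a + b + c) = deriv (oddTheta · τ) 0 *
        (oddTheta (a + b) τ * oddTheta (b + c) τ * oddTheta (a + c) τ) /
        (oddTheta a τ * oddTheta b τ * oddTheta c τ * oddTheta (a + b + c) τ) := by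
  rw [deriv_oddTheta_zero_mul a b c hτ]
  simp only [logDeriv_apply]
  field_simp

/-- The logarithmic derivative of the odd theta function as a Lambert series. -/
lemma logDeriv_oddTheta {z τ : ℂ} (hτ : 0 < τ.im)
    (h1 : ∀ k : ℕ, 1 - cexp (2 * π * Complex.I * (z + τ)) * cexp (2 * π * Complex.I * τ) ^ k ≠ 0)
    (h2 : ∀ k : ℕ, 1 - cexp (2 * π * Complex.I * (-z)) * cexp (2 * π * Complex.I * τ) ^ k ≠ 0) :
    logDeriv (oddTheta · τ) z = 2 * π * Complex.I * (1 / 2 +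
      ∑' k : ℕ, cexp (2 * π * Complex.I * (-z)) * cexp (2 * π * Complex.I * τ) ^ k /
        (1 - cexp (2 * π * Complex.I * (-z)) * cexp (2 * π * Complex.I * τ) ^ k) -
      ∑' k : ℕ, cexp (2 * π * Complex.I * (z + τ)) * cexp (2 * π * Complex.I * τ) ^ k /
        (1 - cexp (2 * π * Complex.I * (z + τ)) * cexp (2 * π * Complex.I * τ) ^ k)) := by
  have hQ := norm_cexp_two_pi_I_mul_lt_one hτ
  have hd := differentiable_pochInf hQ
  have hE := pochInf_ne_zero hQ (one_sub_mul_pow_ne_zero hQ)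
  have hp1 := pochInf_ne_zero hQ h1
  have hp2 := pochInf_ne_zero hQ h2
  have d1 : Differentiable ℂ fun z ↦ cexp (2 * π * Complex.I * (z + τ)) := by fun_prop
  have d2 : Differentiable ℂ fun z ↦ cexp (2 * π * Complex.I * (-z)) := by fun_prop
  have l0 : logDeriv (fun z ↦ cexp (π * Complex.I * z)) z = π * Complex.I := by
    have h : HasDerivAt (fun z ↦ π * Complex.I * z) (π * Complex.I) z := by
      simpa using (hasDerivAt_id z).const_mul (π * Complex.I)
    rw [logDeriv_apply, h.cexp.deriv]
    field_simp
  have l1 : logDeriv (fun z ↦ pochInf (cexp (2 * π * Complex.I * (z + τ)))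
      (cexp (2 * π * Complex.I * τ))) z = -(2 * π * Complex.I * ∑' k : ℕ,
        cexp (2 * π * Complex.I * (z + τ)) * cexp (2 * π * Complex.I * τ) ^ k /
        (1 - cexp (2 * π * Complex.I * (z + τ)) * cexp (2 * π * Complex.I * τ) ^ k)) := by
    have h : HasDerivAt (fun z ↦ 2 * π * Complex.I * (z + τ)) (2 * π * Complex.I) z := by
      simpa using ((hasDerivAt_id z).add_const τ).const_mul (2 * π * Complex.I)
    have := logDeriv_comp (f := fun a ↦ pochInf a (cexp (2 * π * Complex.I * τ)))
      (g := fun z ↦ cexp (2 * π * Complex.I * (z + τ))) (x := z) (hd _) (d1 z)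
    rw [Function.comp_def] at this
    rw [this, logDeriv_pochInf hQ h1, h.cexp.deriv, tsum_neg, neg_mul, ← tsum_mul_right,
      ← tsum_mul_left]
    congr 2; ext k; ring
  have l2 : logDeriv (fun z ↦ pochInf (cexp (2 * π * Complex.I * (-z)))
      (cexp (2 * π * Complex.I * τ))) z = 2 * π * Complex.I * ∑' k : ℕ,
        cexp (2 * π * Complex.I * (-z)) * cexp (2 * π * Complex.I * τ) ^ k /
        (1 - cexp (2 * π * Complex.I * (-z)) * cexp (2 * π * Complex.I * τ) ^ k) := by
    have h : HasDerivAt (fun z ↦ 2 * π * Complex.I * (-z)) (-(2 * π * Complex.I)) z := by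
      simpa using (hasDerivAt_id z).neg.const_mul (2 * π * Complex.I)
    have := logDeriv_comp (f := fun a ↦ pochInf a (cexp (2 * π * Complex.I * τ)))
      (g := fun z ↦ cexp (2 * π * Complex.I * (-z))) (x := z) (hd _) (d2 z)
    rw [Function.comp_def] at this
    rw [this, logDeriv_pochInf hQ h2, h.cexp.deriv, tsum_neg, neg_mul, ← tsum_mul_right,
      ← tsum_mul_left, ← tsum_neg]
    congr 1; ext k; ring
  have hfun : (fun z ↦ oddTheta z τ) = _ := funext fun z ↦ oddTheta_eq_pochInf z hτ
  rw [hfun, logDeriv_const_mul _ _ hE, logDeriv_mul, logDeriv_mul, l0, l1, l2]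
  · ring
  · exact exp_ne_zero _
  · exact hp1
  · fun_prop
  · exact (hd.comp d1) z
  · exact mul_ne_zero (exp_ne_zero _) hp1
  · exact hp2
  · exact DifferentiableAt.mul (by fun_prop) ((hd.comp d1) z)
  · exact (hd.comp d2) z

lemma oddTheta_ne_zero {z τ : ℂ} (hτ : 0 < τ.im)
    (h1 : ∀ k : ℕ, 1 - cexp (2 * π * Complex.I * (z + τ)) * cexp (2 * π * Complex.I * τ) ^ k ≠ 0)
    (h2 : ∀ k : ℕ, 1 - cexp (2 * π * Complex.I * (-z)) * cexp (2 * π * Complex.I * τ) ^ k ≠ 0) :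
    oddTheta z τ ≠ 0 := by
  have hQ := norm_cexp_two_pi_I_mul_lt_one hτ
  rw [oddTheta_eq_pochInf z hτ]
  exact mul_ne_zero (pochInf_ne_zero hQ (one_sub_mul_pow_ne_zero hQ))
    (mul_ne_zero (mul_ne_zero (exp_ne_zero _) (pochInf_ne_zero hQ h1)) (pochInf_ne_zero hQ h2))

/-! ### Hecke's Eisenstein series of weight one -/

lemma oddTheta_add_one_right (z τ : ℂ) : oddTheta z (τ + 1) = oddTheta z τ := by
  rw [oddTheta, oddTheta, jacobiTheta₂, jacobiTheta₂]
  congr 1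
  refine tsum_congr fun n ↦ ?_
  obtain ⟨m, hm⟩ := (Int.even_mul_succ_self n)
  have hm' : (n : ℂ) ^ 2 = 2 * m - n := by
    have : (n * (n + 1) : ℂ) = m + m := mod_cast hm
    linear_combination this
  rw [jacobiTheta₂_term, jacobiTheta₂_term]
  refine (exp_periodic.int_mul (-m) _).symm.trans ?_
  congr 1
  push_cast
  linear_combination (π * Complex.I) * hm'

lemma oddTheta_add_one_left (z τ : ℂ) : oddTheta (z + 1) τ = -oddTheta z τ := by
  rw [oddTheta, oddTheta, show z + 1 + (1 + τ) / 2 = z + (1 + τ) / 2 + 1 by ring,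
    jacobiTheta₂_add_left, mul_add, exp_add, mul_one, exp_pi_mul_I]
  ring

lemma oddTheta_add_self_left (z τ : ℂ) :
    oddTheta (z + τ) τ =
      -cexp (-π * Complex.I * τ) * (cexp (-2 * π * Complex.I * z) * oddTheta z τ) := by
  rw [oddTheta, oddTheta, show z + τ + (1 + τ) / 2 = z + (1 + τ) / 2 + τ by ring,
    jacobiTheta₂_add_left']
  have e : cexp (π * Complex.I * (z + τ)) *
      cexp (-π * Complex.I * (τ + 2 * (z + (1 + τ) / 2))) =
      -cexp (-π * Complex.I * τ) * (cexp (-2 * π * Complex.I * z) * cexp (π * Complex.I * z)) := by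
    rw [← neg_one_mul (cexp (-π * Complex.I * τ)), ← exp_pi_mul_I]
    simp only [← exp_add]
    refine (exp_periodic.int_mul 1 _).symm.trans ?_
    congr 1
    push_cast
    ring
  linear_combination jacobiTheta₂ (z + (1 + τ) / 2) τ * e

/-- The exponential factor in the inversion formula is quadratic in `z`; the linear terms coming
from the shift by the half period cancel. -/
lemma oddTheta_inversion (z : ℂ) {τ : ℂ} (hτ : τ ≠ 0) :
    oddTheta z τ = 1 / (-Complex.I * τ) ^ (1 / 2 : ℂ) *
      cexp (π * Complex.I * (1 - (1 + τ) ^ 2 / (4 * τ))) *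
      (cexp (-π * Complex.I * z ^ 2 / τ) * oddTheta (z / τ) (-1 / τ)) := by
  rw [oddTheta, oddTheta, jacobiTheta₂_functional_equation (z + (1 + τ) / 2)]
  have h : z / τ + (1 + -1 / τ) / 2 = (z + (1 + τ) / 2) / τ + (-1 / τ) := by field_simp; ring
  rw [h, jacobiTheta₂_add_left']
  have e : cexp (π * Complex.I * z) * cexp (-π * Complex.I * (z + (1 + τ) / 2) ^ 2 / τ) =
      cexp (π * Complex.I * (1 - (1 + τ) ^ 2 / (4 * τ))) * cexp (-π * Complex.I * z ^ 2 / τ) *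
      cexp (π * Complex.I * (z / τ)) *
      cexp (-π * Complex.I * (-1 / τ + 2 * ((z + (1 + τ) / 2) / τ))) := by
    simp only [← exp_add]
    congr 1
    field_simp
    ring
  linear_combination (1 / (-Complex.I * τ) ^ (1 / 2 : ℂ) *
    jacobiTheta₂ ((z + (1 + τ) / 2) / τ) (-1 / τ)) * e

open Classical in
/-- Hecke's weight one form `ζ(rτ + s) - r η(τ) - s η(1)` attached to a point `rτ + s` of `ℂ` modulo
the lattice `ℤτ + ℤ`, written as a logarithmic derivative of the odd theta function. At the
zeros of the theta function (the lattice points) it is given the value `0`, so that its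
transformation laws hold without exception. -/
def heckeZ (r s τ : ℂ) : ℂ :=
  if oddTheta (r * τ + s) τ = 0 then 0
  else logDeriv (oddTheta · τ) (r * τ + s) + 2 * π * Complex.I * r

lemma heckeZ_add_one_right (r s τ : ℂ) : heckeZ r (s + 1) τ = heckeZ r s τ := by
  have h : deriv (oddTheta · τ) (r * τ + s + 1) = -deriv (oddTheta · τ) (r * τ + s) := by
    rw [← deriv_comp_add_const (f := fun z ↦ oddTheta z τ)]
    simp only [oddTheta_add_one_left, deriv.fun_neg]
  simp only [heckeZ, ← add_assoc, oddTheta_add_one_left, neg_eq_zero, logDeriv_apply, h,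
    neg_div_neg_eq]

lemma heckeZ_add_one_left (r s : ℂ) {τ : ℂ} (hτ : 0 < τ.im) :
    heckeZ (r + 1) s τ = heckeZ r s τ := by
  have e : (r + 1) * τ + s = r * τ + s + τ := by ring
  simp only [heckeZ, e, oddTheta_add_self_left, mul_eq_zero, neg_eq_zero, exp_ne_zero, false_or]
  split_ifs with h0
  · rfl
  have h : logDeriv (oddTheta · τ) (r * τ + s + τ) =
      -2 * π * Complex.I + logDeriv (oddTheta · τ) (r * τ + s) := by
    have h1 : logDeriv (oddTheta · τ) (r * τ + s + τ) =
        logDeriv (fun z ↦ oddTheta (z + τ) τ) (r * τ + s) := by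
      rw [logDeriv_apply, logDeriv_apply, ← deriv_comp_add_const (f := fun z ↦ oddTheta z τ)]
    have hl : HasDerivAt (fun z ↦ -2 * π * Complex.I * z) (-2 * π * Complex.I) (r * τ + s) := by
      simpa using (hasDerivAt_id (r * τ + s)).const_mul (-2 * π * Complex.I)
    rw [h1]
    simp only [oddTheta_add_self_left]
    rw [logDeriv_const_mul _ _ (neg_ne_zero.mpr (exp_ne_zero _)), logDeriv_mul,
      logDeriv_apply (fun z ↦ cexp _), hl.cexp.deriv]
    · field_simp
    · exact exp_ne_zero _
    · exact h0
    · fun_prop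
    · exact differentiable_oddTheta hτ _
  rw [h]
  ring

lemma heckeZ_add_int (r s : ℂ) {τ : ℂ} (hτ : 0 < τ.im) (m n : ℤ) :
    heckeZ (r + m) (s + n) τ = heckeZ r s τ := by
  have h1 : Function.Periodic (fun r ↦ heckeZ r (s + n) τ) 1 := fun r ↦ heckeZ_add_one_left r _ hτ
  have h2 : Function.Periodic (fun s ↦ heckeZ r s τ) 1 := fun s ↦ heckeZ_add_one_right r s τ
  have h3 := h1.int_mul m r
  have h4 := h2.int_mul n s
  simp only [mul_one] at h3 h4
  rw [h3, h4]

lemma heckeZ_translate (r s τ : ℂ) : heckeZ r s (τ + 1) = heckeZ r (r + s) τ := by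
  simp only [heckeZ, oddTheta_add_one_right, show r * (τ + 1) + s = r * τ + (r + s) by ring]

lemma heckeZ_inversion (r s : ℂ) {τ : ℂ} (hτ : 0 < τ.im) :
    heckeZ r s (-1 / τ) = τ * heckeZ s (-r) τ := by
  have h0 : τ ≠ 0 := by rintro rfl; simp at hτ
  have hτ' : 0 < (-1 / τ).im := by
    rw [div_eq_mul_inv, neg_one_mul, neg_im, inv_im, neg_div, neg_neg]
    exact div_pos hτ (normSq_pos.mpr h0)
  have hK : 1 / (-Complex.I * τ) ^ (1 / 2 : ℂ) *
      cexp (π * Complex.I * (1 - (1 + τ) ^ 2 / (4 * τ))) ≠ 0 := by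
    refine mul_ne_zero (one_div_ne_zero ?_) (exp_ne_zero _)
    simp [cpow_eq_zero_iff, h0]
  have e : r * (-1 / τ) + s = (s * τ + -r) / τ := by field_simp; ring
  have hz : oddTheta (r * (-1 / τ) + s) (-1 / τ) = 0 ↔ oddTheta (s * τ + -r) τ = 0 := by
    rw [e, oddTheta_inversion (s * τ + -r) h0, mul_eq_zero, or_iff_right hK, mul_eq_zero,
      or_iff_right (exp_ne_zero _)]
  simp only [heckeZ, hz]
  split_ifs with hne
  · simp
  have hne' := mt hz.mp hne
  set z := s * τ + -r with hzdef
  have h : logDeriv (oddTheta · τ) z =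
      -2 * π * Complex.I * z / τ + 1 / τ * logDeriv (oddTheta · (-1 / τ)) (z / τ) := by
    have hl : HasDerivAt (fun z ↦ -π * Complex.I * z ^ 2 / τ) (-2 * π * Complex.I * z / τ) z := by
      refine (((hasDerivAt_pow 2 z).const_mul (-π * Complex.I)).div_const τ).congr_deriv ?_
      simp; ring
    have hfun : (fun z ↦ oddTheta z τ) = _ := funext fun z ↦ oddTheta_inversion z h0
    have hc : HasDerivAt (fun z ↦ oddTheta (z / τ) (-1 / τ))
        (deriv (oddTheta · (-1 / τ)) (z / τ) * (1 / τ)) z :=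
      HasDerivAt.comp (h₂ := fun z ↦ oddTheta z (-1 / τ)) (h := fun z ↦ z / τ) z
        (differentiable_oddTheta hτ' (z / τ)).hasDerivAt ((hasDerivAt_id z).div_const τ)
    rw [hfun, logDeriv_const_mul _ _ hK, logDeriv_mul, logDeriv_apply (fun z ↦ cexp _),
      hl.cexp.deriv, logDeriv_apply, logDeriv_apply, hc.deriv]
    · field_simp
    · exact exp_ne_zero _
    · rwa [← e]
    · fun_prop
    · exact hc.differentiableAt
  rw [e, h, hzdef]
  field_simp
  ring

/-- The action of the modular group, with integer entries. -/
lemma coe_smul_eq_div (γ : SL(2, ℤ)) (τ : ℍ) : ((γ • τ : ℍ) : ℂ) =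
    ((γ 0 0 : ℤ) * (τ : ℂ) + (γ 0 1 : ℤ)) / ((γ 1 0 : ℤ) * (τ : ℂ) + (γ 1 1 : ℤ)) := by
  rw [coe_specialLinearGroup_apply]
  simp

lemma mul_coe_add_ne_zero (γ : SL(2, ℤ)) (τ : ℍ) :
    ((γ 1 0 : ℤ) * (τ : ℂ) + (γ 1 1 : ℤ)) ≠ 0 := by
  rw [← ModularGroup.denom_apply]
  exact denom_ne_zero _ τ

lemma coe_smul_mul (γ : SL(2, ℤ)) (τ : ℍ) :
    ((γ • τ : ℍ) : ℂ) * ((γ 1 0 : ℤ) * (τ : ℂ) + (γ 1 1 : ℤ)) =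
      (γ 0 0 : ℤ) * (τ : ℂ) + (γ 0 1 : ℤ) := by
  rw [coe_smul_eq_div, div_mul_cancel₀ _ (mul_coe_add_ne_zero γ τ)]

lemma SL2_det (γ : SL(2, ℤ)) :
    ((γ 0 0 : ℤ) : ℂ) * (γ 1 1 : ℤ) - ((γ 0 1 : ℤ) : ℂ) * (γ 1 0 : ℤ) = 1 := by
  have h := γ.det_coe
  rw [Matrix.det_fin_two] at h
  exact_mod_cast h

/-- Weight one equivariance under the full modular group, which acts on the characteristic
`(r, s)` from the right. -/
theorem heckeZ_smul (γ : SL(2, ℤ)) (r s : ℂ) (τ : ℍ) :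
    heckeZ r s ((γ • τ : ℍ) : ℂ) = ((γ 1 0 : ℤ) * (τ : ℂ) + (γ 1 1 : ℤ)) *
      heckeZ (r * (γ 0 0 : ℤ) + s * (γ 1 0 : ℤ)) (r * (γ 0 1 : ℤ) + s * (γ 1 1 : ℤ)) τ := by
  have hγ : γ ∈ Subgroup.closure {ModularGroup.S, ModularGroup.T} := by
    simp [SpecialLinearGroup.SL2Z_generators]
  induction hγ using Subgroup.closure_induction generalizing r s τ with
  | mem x hx =>
    rcases hx with rfl | rfl
    · rw [coe_smul_eq_div]
      simpa [ModularGroup.S] using heckeZ_inversion r s τ.im_pos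
    · rw [coe_smul_eq_div]
      simpa [ModularGroup.T] using heckeZ_translate r s τ
  | one => simp
  | mul x y _ _ hx hy =>
    have hj : ((x * y) 1 0 : ℤ) * (τ : ℂ) + ((x * y) 1 1 : ℤ) =
        ((x 1 0 : ℤ) * ((y • τ : ℍ) : ℂ) + (x 1 1 : ℤ)) *
        ((y 1 0 : ℤ) * (τ : ℂ) + (y 1 1 : ℤ)) := by
      have := coe_smul_mul y τ
      simp only [Matrix.SpecialLinearGroup.coe_mul, Matrix.mul_apply, Fin.sum_univ_two]
      push_cast
      linear_combination -((x 1 0 : ℤ) : ℂ) * this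
    rw [mul_smul, hx, hy, hj, mul_assoc]
    congr 3 <;> simp [Matrix.mul_apply, Fin.sum_univ_two] <;> ring
  | inv x _ hx =>
    have hdet := SL2_det x
    have h00 : (x⁻¹ 0 0 : ℤ) = x 1 1 := by simp [Matrix.SpecialLinearGroup.SL2_inv_expl]
    have h01 : (x⁻¹ 0 1 : ℤ) = -x 0 1 := by simp [Matrix.SpecialLinearGroup.SL2_inv_expl]
    have h10 : (x⁻¹ 1 0 : ℤ) = -x 1 0 := by simp [Matrix.SpecialLinearGroup.SL2_inv_expl]
    have h11 : (x⁻¹ 1 1 : ℤ) = x 0 0 := by simp [Matrix.SpecialLinearGroup.SL2_inv_expl]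
    have h := hx (r * (x⁻¹ 0 0 : ℤ) + s * (x⁻¹ 1 0 : ℤ)) (r * (x⁻¹ 0 1 : ℤ) + s * (x⁻¹ 1 1 : ℤ))
      (x⁻¹ • τ)
    have hj : ((x 1 0 : ℤ) * ((x⁻¹ • τ : ℍ) : ℂ) + (x 1 1 : ℤ)) *
        ((x⁻¹ 1 0 : ℤ) * (τ : ℂ) + (x⁻¹ 1 1 : ℤ)) = 1 := by
      have := coe_smul_mul x⁻¹ τ
      simp only [h00, h01, h10, h11] at this ⊢
      push_cast at this ⊢
      linear_combination ((x 1 0 : ℤ) : ℂ) * this + hdet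
    have er : (r * (x⁻¹ 0 0 : ℤ) + s * (x⁻¹ 1 0 : ℤ)) * (x 0 0 : ℤ) +
        (r * (x⁻¹ 0 1 : ℤ) + s * (x⁻¹ 1 1 : ℤ)) * (x 1 0 : ℤ) = r := by
      simp only [h00, h01, h10, h11]; push_cast; linear_combination r * hdet
    have es : (r * (x⁻¹ 0 0 : ℤ) + s * (x⁻¹ 1 0 : ℤ)) * (x 0 1 : ℤ) +
        (r * (x⁻¹ 0 1 : ℤ) + s * (x⁻¹ 1 1 : ℤ)) * (x 1 1 : ℤ) = s := by
      simp only [h00, h01, h10, h11]; push_cast; linear_combination s * hdet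
    rw [smul_inv_smul, er, es] at h
    rw [h, ← mul_assoc, mul_comm (_ + _) (_ + _), hj, one_mul]

/-- The partial Lambert series `∑ q^n / (1 - q^n)` over `n = a, a + p, a + 2p, …`. -/
def lambertSum (p : ℕ) (τ : ℍ) (a : ℕ) : ℂ :=
  ∑' k : ℕ, nome τ ^ (a + p * k) / (1 - nome τ ^ (a + p * k))

/-- The weight one Eisenstein series of the residue class `j ≠ 0` modulo `p`:
`1/2 - j/p + ∑ (±1) q^n / (1 - q^n)`, summed over the `n ≡ ±j`, where `j` is represented in
`0 < j < p`. -/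
def eisensteinPart (p : ℕ) (j : ZMod p) (τ : ℍ) : ℂ :=
  1 / 2 - (j.val : ℂ) / p + lambertSum p τ j.val - lambertSum p τ (p - j.val)

lemma norm_nome_lt_one (τ : ℍ) : ‖nome τ‖ < 1 := norm_cexp_two_pi_I_mul_lt_one τ.im_pos

lemma one_sub_nome_pow_ne_zero (τ : ℍ) {n : ℕ} (hn : n ≠ 0) : 1 - nome τ ^ n ≠ 0 := by
  intro h
  have h1 : ‖nome τ ^ n‖ < 1 := by
    rw [norm_pow]; exact pow_lt_one₀ (norm_nonneg _) (norm_nome_lt_one τ) hn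
  rw [← sub_eq_zero.mp h, norm_one] at h1
  exact lt_irrefl _ h1

lemma nome_pow_eq_cexp (n : ℕ) (τ : ℍ) : nome τ ^ n = cexp (2 * π * Complex.I * (n * τ)) := by
  rw [nome, ← exp_nat_mul]; congr 1; ring

lemma natCast_mul_im_pos {p : ℕ} (hp : 0 < p) (τ : ℍ) : 0 < ((p : ℂ) * (τ : ℂ)).im := by
  have := τ.im_pos
  simp
  positivity

lemma one_sub_nome_pow_mul_ne_zero (p : ℕ) (τ : ℍ) {n : ℕ} (hn : n ≠ 0) (k : ℕ) :
    1 - nome τ ^ n * (nome τ ^ p) ^ k ≠ 0 := by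
  rw [← pow_mul, ← pow_add]
  exact one_sub_nome_pow_ne_zero τ (by lia)

/-- The `q`-expansion of Hecke's form at the point `-nτ` for the lattice `ℤpτ + ℤ`. -/
lemma heckeZ_eq_lambertSum {p n : ℕ} (hn : 0 < n) (hnp : n < p) (τ : ℍ) :
    heckeZ (-(n : ℂ) / p) 0 (p * τ) = 2 * π * Complex.I *
      (1 / 2 - (n : ℂ) / p + lambertSum p τ n - lambertSum p τ (p - n)) := by
  have hp : 0 < p := hn.trans hnp
  have hp' : (p : ℂ) ≠ 0 := by exact_mod_cast hp.ne'
  have hτ := natCast_mul_im_pos hp τ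
  have e : -(n : ℂ) / p * (p * τ) + 0 = -(n * τ) := by field_simp; ring
  have e1 : cexp (2 * π * Complex.I * (-(n * τ) + p * τ)) = nome τ ^ (p - n) := by
    rw [nome_pow_eq_cexp, Nat.cast_sub hnp.le]; congr 1; ring
  have e2 : cexp (2 * π * Complex.I * (-(-(n * τ)))) = nome τ ^ n := by
    rw [nome_pow_eq_cexp, neg_neg]
  have e3 : cexp (2 * π * Complex.I * (p * τ)) = nome τ ^ p := (nome_pow_eq_cexp p τ).symm
  have h1 (k : ℕ) : 1 - cexp (2 * π * Complex.I * (-(n * τ) + p * τ)) *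
      cexp (2 * π * Complex.I * (p * τ)) ^ k ≠ 0 := by
    rw [e1, e3]; exact one_sub_nome_pow_mul_ne_zero p τ (by lia) k
  have h2 (k : ℕ) : 1 - cexp (2 * π * Complex.I * (-(-(n * τ)))) *
      cexp (2 * π * Complex.I * (p * τ)) ^ k ≠ 0 := by
    rw [e2, e3]; exact one_sub_nome_pow_mul_ne_zero p τ hn.ne' k
  rw [heckeZ, e, if_neg (oddTheta_ne_zero hτ h1 h2), logDeriv_oddTheta hτ h1 h2, e1, e2, e3]
  simp only [lambertSum, pow_add, pow_mul]
  ring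

lemma eisensteinPart_eq_heckeZ {p : ℕ} [NeZero p] {j : ZMod p} (hj : j ≠ 0) {n : ℤ}
    (hn : (n : ZMod p) = j) (m : ℤ) (τ : ℍ) :
    heckeZ (-(n : ℂ) / p) m (p * τ) = 2 * π * Complex.I * eisensteinPart p j τ := by
  have hp : 0 < p := Nat.pos_of_ne_zero (NeZero.ne p)
  have hp' : (p : ℂ) ≠ 0 := by exact_mod_cast hp.ne'
  have hτ := natCast_mul_im_pos hp τ
  have hv : 0 < j.val := Nat.pos_of_ne_zero (by simpa using hj)
  have h1 : ((n - j.val : ℤ) : ZMod p) = 0 := by simp [hn]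
  obtain ⟨k, hk⟩ := (ZMod.intCast_zmod_eq_zero_iff_dvd _ p).mp h1
  have h2 : -(n : ℂ) / p = -(j.val : ℂ) / p + (-k : ℤ) := by
    have : (n : ℂ) - j.val = p * k := by exact_mod_cast hk
    field_simp
    push_cast
    linear_combination -this
  rw [h2, ← zero_add (m : ℂ), heckeZ_add_int _ _ hτ, heckeZ_eq_lambertSum hv (ZMod.val_lt j),
    eisensteinPart]

/-- The diamond operators permute the Eisenstein series of the residue classes. -/
theorem eisensteinPart_smul {p : ℕ} [NeZero p] {γ : SL(2, ℤ)} (hγ : γ ∈ Gamma0 p) {j : ZMod p}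
    (hj : j * ((γ 0 0 : ℤ) : ZMod p) ≠ 0) (τ : ℍ) :
    eisensteinPart p j (γ • τ) = ((γ 1 0 : ℤ) * (τ : ℂ) + (γ 1 1 : ℤ)) *
      eisensteinPart p (j * ((γ 0 0 : ℤ) : ZMod p)) τ := by
  have hp : 0 < p := Nat.pos_of_ne_zero (NeZero.ne p)
  have hp' : (p : ℂ) ≠ 0 := by exact_mod_cast hp.ne'
  obtain ⟨c, hc⟩ := (ZMod.intCast_zmod_eq_zero_iff_dvd _ p).mp (Gamma0_mem.mp hγ)
  have hdet : (!![γ 0 0, p * γ 0 1; c, γ 1 1] : Matrix (Fin 2) (Fin 2) ℤ).det = 1 := by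
    have h := γ.det_coe
    rw [Matrix.det_fin_two] at h
    rw [Matrix.det_fin_two_of]
    rw [hc] at h
    linear_combination h
  -- conjugation by `τ ↦ pτ` turns `γ` into an element of the full modular group
  let γ' : SL(2, ℤ) := ⟨!![γ 0 0, p * γ 0 1; c, γ 1 1], hdet⟩
  let τ' : ℍ := ⟨p * τ, natCast_mul_im_pos hp τ⟩
  have hcC : ((γ 1 0 : ℤ) : ℂ) = p * c := by rw [hc]; push_cast; ring
  have hτ' : ((γ' • τ' : ℍ) : ℂ) = p * ((γ • τ : ℍ) : ℂ) := by
    rw [coe_smul_eq_div, coe_smul_eq_div]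
    simp only [γ', τ', hcC]
    simp
    ring
  have hj0 : j ≠ 0 := left_ne_zero_of_mul hj
  have h1 := eisensteinPart_eq_heckeZ hj0 (n := j.val) (by simp) 0 (γ • τ)
  have h2 := heckeZ_smul γ' (-(j.val : ℂ) / p) 0 τ'
  have h3 := eisensteinPart_eq_heckeZ hj (n := j.val * γ 0 0) (by simp) (-(j.val * γ 0 1)) τ
  have e1 : -(j.val : ℂ) / p * ((γ' 0 0 : ℤ) : ℂ) + 0 * ((γ' 1 0 : ℤ) : ℂ) =
      -((j.val * γ 0 0 : ℤ) : ℂ) / p := by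
    simp [γ']; ring
  have e2 : -(j.val : ℂ) / p * ((γ' 0 1 : ℤ) : ℂ) + 0 * ((γ' 1 1 : ℤ) : ℂ) =
      ((-(j.val * γ 0 1) : ℤ) : ℂ) := by
    simp [γ']; field_simp
  rw [hτ', e1, e2] at h2
  have e3 : ((γ' 1 0 : ℤ) : ℂ) * (τ' : ℂ) + ((γ' 1 1 : ℤ) : ℂ) =
      (γ 1 0 : ℤ) * (τ : ℂ) + (γ 1 1 : ℤ) := by
    simp [γ', τ', hcC]; ring
  rw [e3, show (τ' : ℂ) = p * τ from rfl, h3] at h2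
  simp only [Int.cast_natCast, Int.cast_zero] at h1
  rw [h1] at h2
  exact mul_left_cancel₀ two_pi_I_ne_zero (by rw [h2]; ring)

/-! ### Dirichlet L-functions at zero -/

lemma isBigO_exp_neg_sub (a : ℝ) :
    (fun t : ℝ ↦ Real.exp (-(a * t)) - 1 + a * t) =O[𝓝[>] 0] fun t ↦ t ^ 2 := by
  have h := Real.exp_sub_sum_range_isBigO_pow 2
  have ht : Tendsto (fun t : ℝ ↦ -(a * t)) (𝓝[>] 0) (𝓝 0) := by
    have : Tendsto (fun t : ℝ ↦ -(a * t)) (𝓝 0) (𝓝 (-(a * 0))) :=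
      Continuous.tendsto (by fun_prop) 0
    simpa using this.mono_left nhdsWithin_le_nhds
  have h2 := h.comp_tendsto ht
  refine (h2.congr' (.of_forall fun t ↦ ?_) (.of_forall fun t ↦ rfl)).trans ?_
  · simp [Finset.sum_range_succ]; ring
  · refine IsBigO.of_bound (a ^ 2) (.of_forall fun t ↦ ?_)
    simp [mul_pow]

lemma isBigO_inv_one_sub_exp {p : ℝ} (hp : 0 < p) :
    (fun t : ℝ ↦ (1 - Real.exp (-(p * t)))⁻¹) =O[𝓝[>] 0] fun t ↦ t⁻¹ := by
  refine IsBigO.of_bound (2 / p) ?_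
  have h1 : ∀ᶠ t : ℝ in 𝓝[>] 0, t < 1 / p :=
    nhdsWithin_le_nhds (eventually_lt_nhds (by positivity))
  filter_upwards [h1, self_mem_nhdsWithin] with t ht ht0
  rw [Set.mem_Ioi] at ht0
  have hpt : 0 < p * t := by positivity
  have hpt1 : p * t < 1 := by rwa [lt_div_iff₀' hp] at ht
  have h2 : Real.exp (-(p * t)) ≤ 1 - p * t / 2 := by
    have h3 := Real.add_one_le_exp (p * t)
    rw [Real.exp_neg]
    refine (inv_anti₀ (by positivity) h3).trans ?_
    rw [inv_le_iff_one_le_mul₀ (by positivity)]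
    nlinarith
  have h4 : p * t / 2 ≤ 1 - Real.exp (-(p * t)) := by linarith
  rw [Real.norm_of_nonneg (inv_nonneg.mpr (by linarith)), Real.norm_of_nonneg (by positivity)]
  refine (inv_anti₀ (by positivity) h4).trans (le_of_eq ?_)
  field_simp

lemma isBigO_residue_zero {p : ℝ} (hp : 0 < p) (j : ℝ) :
    (fun t : ℝ ↦ (Real.exp (-(j * t)) - 1) * (1 - Real.exp (-(p * t)))⁻¹ + j / p * Real.exp (-t))
      =O[𝓝[>] 0] fun t ↦ t := by
  have h := (isBigO_exp_neg_sub j).add (((isBigO_exp_neg_sub 1).sub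
    (isBigO_exp_neg_sub (p + 1))).const_mul_left (j / p))
  refine ((h.mul (isBigO_inv_one_sub_exp hp)).congr' ?_ ?_)
  · filter_upwards [self_mem_nhdsWithin] with t ht
    rw [Set.mem_Ioi] at ht
    have h1 : 1 - Real.exp (-(p * t)) ≠ 0 := by
      have : Real.exp (-(p * t)) < 1 := by
        rw [Real.exp_lt_one_iff]; have : 0 < p * t := by positivity
        linarith
      linarith
    have hpp : p / p = 1 := div_self hp.ne'
    have h2 : Real.exp (-((p + 1) * t)) = Real.exp (-(p * t)) * Real.exp (-t) := by
      rw [← Real.exp_add]; congr 1; ring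
    rw [h2, one_mul]
    have h3 := mul_inv_cancel₀ h1
    linear_combination (j / p * Real.exp (-t)) * h3 -
      (j * t * (1 - Real.exp (-(p * t)))⁻¹) * hpp
  · filter_upwards [self_mem_nhdsWithin] with t ht
    have : t ≠ 0 := ne_of_gt ht
    field_simp

lemma isBigO_residue_atTop {p : ℝ} (hp : 0 < p) {j : ℝ} (hj : 1 ≤ j) :
    (fun t : ℝ ↦ Real.exp (-(j * t)) * (1 - Real.exp (-(p * t)))⁻¹ + j / p * Real.exp (-t))
      =O[atTop] fun t ↦ Real.exp (-1 * t) := by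
  have h1 : (fun t : ℝ ↦ Real.exp (-(j * t))) =O[atTop] fun t ↦ Real.exp (-1 * t) := by
    refine IsBigO.of_bound 1 ?_
    filter_upwards [eventually_ge_atTop 0] with t ht
    rw [Real.norm_of_nonneg (Real.exp_pos _).le, Real.norm_of_nonneg (Real.exp_pos _).le, one_mul,
      Real.exp_le_exp]
    nlinarith
  have h2 : (fun t : ℝ ↦ (1 - Real.exp (-(p * t)))⁻¹) =O[atTop] fun _ ↦ (1 : ℝ) := by
    have : Tendsto (fun t : ℝ ↦ (1 - Real.exp (-(p * t)))⁻¹) atTop (𝓝 (1 - 0)⁻¹) := by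
      refine Tendsto.inv₀ (Tendsto.const_sub _ ?_) (by simp)
      exact Real.tendsto_exp_neg_atTop_nhds_zero.comp (tendsto_id.const_mul_atTop hp)
    exact this.isBigO_one ℝ
  have h3 : (fun t : ℝ ↦ j / p * Real.exp (-t)) =O[atTop] fun t ↦ Real.exp (-1 * t) := by
    refine IsBigO.of_bound ‖j / p‖ (.of_forall fun t ↦ ?_)
    rw [norm_mul, neg_one_mul]
  simpa using (h1.mul h2).add (h3.congr_right fun t ↦ (mul_one _).symm)

/-- The value at `0` of a nontrivial Dirichlet `L`-function is `-∑ χ(j) j / p = -B_{1,χ}`. It is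
read off from the Mellin transform of `∑ χ(n) e^{-nt} - c e^{-t}`, where `c` is chosen so that
this function vanishes at `t = 0`; then `Γ(s) (L(s, χ) - c)` is holomorphic at `s = 0`. -/
theorem LFunction_zero {p : ℕ} [NeZero p] {χ : DirichletCharacter ℂ p} (hp : 1 < p) (hχ : χ ≠ 1) :
    DirichletCharacter.LFunction χ 0 = -∑ j : ZMod p, χ j * ((j.val : ℂ) / p) := by
  have : Fact (1 < p) := ⟨hp⟩
  have hp0 : (0 : ℝ) < p := by exact_mod_cast zero_lt_one.trans hp
  set c : ℂ := -∑ j : ZMod p, χ j * ((j.val : ℂ) / p) with hc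
  have hsum : ∑ j : ZMod p, χ j = 0 := χ.sum_eq_zero_of_ne_one hχ
  have hχ0 : χ 0 = 0 := χ.map_nonunit not_isUnit_zero
  let g (j : ZMod p) (t : ℝ) : ℝ :=
    Real.exp (-(j.val * t)) * (1 - Real.exp (-(p * t)))⁻¹ + j.val / p * Real.exp (-t)
  let ψ (t : ℝ) : ℂ := ∑ j : ZMod p, χ j * (g j t : ℂ)
  have hψ_top : ψ =O[atTop] fun t ↦ Real.exp (-1 * t) := by
    refine IsBigO.fun_sum (A := fun (j : ZMod p) t ↦ χ j * (g j t : ℂ)) fun j _ ↦ ?_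
    rcases eq_or_ne j 0 with rfl | hj
    · simp only [hχ0, zero_mul]
      exact isBigO_zero _ _
    · refine IsBigO.const_mul_left ?_ _
      refine (isBigO_ofReal_left.mpr (isBigO_residue_atTop hp0 (j := j.val) ?_))
      exact_mod_cast Nat.one_le_iff_ne_zero.mpr (by simpa using hj)
  have hψ_zero : ψ =O[𝓝[>] 0] fun t ↦ t ^ (-(-1) : ℝ) := by
    have h : (fun t ↦ ∑ j : ZMod p, χ j * (((Real.exp (-(j.val * t)) - 1) *
        (1 - Real.exp (-(p * t)))⁻¹ + j.val / p * Real.exp (-t) : ℝ) : ℂ)) =O[𝓝[>] 0]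
        fun t : ℝ ↦ t := by
      refine IsBigO.fun_sum fun (j : ZMod p) _ ↦ ?_
      exact (isBigO_ofReal_left.mpr (isBigO_residue_zero hp0 j.val)).const_mul_left _
    refine h.congr (fun t ↦ ?_) (fun t ↦ by simp)
    have h1 : ∑ j : ZMod p, χ j * ((1 - Real.exp (-(p * t)) : ℝ) : ℂ)⁻¹ = 0 := by
      rw [← Finset.sum_mul, hsum, zero_mul]
    rw [← add_zero (∑ j : ZMod p, _), ← h1, ← Finset.sum_add_distrib]
    refine Finset.sum_congr rfl fun j _ ↦ ?_
    simp only [g]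
    push_cast
    ring
  have hψ_int : MeasureTheory.LocallyIntegrableOn ψ (Set.Ioi 0) := by
    refine ContinuousOn.locallyIntegrableOn ?_ measurableSet_Ioi
    have hden (t : ℝ) (ht : t ∈ Set.Ioi (0 : ℝ)) : 1 - Real.exp (-(p * t)) ≠ 0 := by
      have : Real.exp (-(p * t)) < 1 := by
        rw [Real.exp_lt_one_iff, neg_lt_zero]; exact mul_pos hp0 ht
      linarith
    refine continuousOn_finsetSum _ fun j _ ↦ continuousOn_const.mul ?_
    refine continuous_ofReal.comp_continuousOn ?_
    refine (ContinuousOn.mul (by fun_prop) (ContinuousOn.inv₀ (by fun_prop) hden)).add (by fun_prop)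
  have hmel (s : ℂ) (hs : -1 < s.re) : DifferentiableAt ℂ (mellin ψ) s :=
    mellin_differentiableAt_of_isBigO_rpow_exp one_pos hψ_int hψ_top hψ_zero hs
  have key (s : ℂ) (hs : 1 < s.re) :
      mellin ψ s = Complex.Gamma s * (DirichletCharacter.LFunction χ s - c) := by
    -- the vacant index `n = 0` of the Dirichlet series carries the term `-c e^{-t}`
    let a (n : ℕ) : ℂ := if n = 0 then -c else χ n
    let P (n : ℕ) : ℝ := if n = 0 then 1 else n
    have hP (n : ℕ) : 0 < P n := by
      rcases Nat.eq_zero_or_pos n with rfl | hn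
      · simp [P]
      · simpa [P, hn.ne'] using hn
    have hsum1 : Summable fun n ↦ ‖a n‖ / P n ^ s.re := by
      rw [← summable_nat_add_iff 1]
      refine Summable.of_nonneg_of_le (fun n ↦ div_nonneg (norm_nonneg _)
        (Real.rpow_nonneg (hP _).le _)) (fun n ↦ ?_)
        ((summable_nat_add_iff 1).mpr (Real.summable_one_div_nat_rpow.mpr hs))
      simp only [a, P, Nat.add_eq_zero_iff, one_ne_zero, and_false, if_false]
      gcongr
      exact χ.norm_le_one _
    have hF (t : ℝ) (ht : t ∈ Set.Ioi (0 : ℝ)) :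
        HasSum (fun n ↦ a n * (Real.exp (-P n * t) : ℂ)) (ψ t) := by
      rw [Set.mem_Ioi] at ht
      have hlt (x : ℝ) (hx : 0 < x) : ‖Real.exp (-(x * t))‖ < 1 := by
        rw [Real.norm_of_nonneg (Real.exp_pos _).le, Real.exp_lt_one_iff]
        have := mul_pos hx ht
        linarith
      let f (n : ℕ) : ℂ := χ n * (Real.exp (-(n * t)) : ℂ)
      have hf : Summable f := by
        refine Summable.of_norm_bounded (summable_geometric_of_norm_lt_one (hlt 1 one_pos))
          fun n ↦ ?_
        rw [norm_mul, norm_real, Real.norm_of_nonneg (Real.exp_pos _).le, ← Real.exp_nat_mul,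
          one_mul, mul_neg]
        exact mul_le_of_le_one_left (Real.exp_pos _).le (χ.norm_le_one _)
      have h1 : ∑' n, f n = ∑ j : ZMod p, χ j *
          ((Real.exp (-(j.val * t)) * (1 - Real.exp (-(p * t)))⁻¹ : ℝ) : ℂ) := by
        rw [Nat.sumByResidueClasses hf p]
        refine Finset.sum_congr rfl fun j _ ↦ ?_
        rw [← tsum_geometric_of_norm_lt_one (hlt p hp0), ← tsum_mul_left, ofReal_tsum,
          ← tsum_mul_left]
        refine tsum_congr fun m ↦ ?_
        simp only [f]
        congr 1
        · simp
        · rw [← Real.exp_nat_mul, ← Real.exp_add]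
          congr 2; push_cast; ring
      have h2 := hf.hasSum.add (hasSum_ite_eq 0 (-c * (Real.exp (-t) : ℂ)))
      rw [h1] at h2
      have h3 : ψ t = ∑ j : ZMod p, χ j * ((Real.exp (-(j.val * t)) *
          (1 - Real.exp (-(p * t)))⁻¹ : ℝ) : ℂ) + -c * (Real.exp (-t) : ℂ) := by
        rw [hc, neg_neg, Finset.sum_mul, ← Finset.sum_add_distrib]
        refine Finset.sum_congr rfl fun j _ ↦ ?_
        simp only [g]
        push_cast
        ring
      rw [h3]
      refine h2.congr_fun fun n ↦ ?_
      rcases eq_or_ne n 0 with rfl | hn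
      · simp [a, P, f, hχ0]
      · simp [a, P, f, hn]
    have h1 := hasSum_mellin (fun n ↦ Or.inr (hP n)) (zero_lt_one.trans hs) hF hsum1
    have h2 : HasSum (LSeries.term (χ ·) s) (DirichletCharacter.LFunction χ s) := by
      rw [DirichletCharacter.LFunction_eq_LSeries χ hs]
      exact (DirichletCharacter.LSeriesSummable_of_one_lt_re χ hs).LSeriesHasSum
    have h3 := (h2.add (hasSum_ite_eq 0 (-c))).mul_left (Complex.Gamma s)
    rw [sub_eq_add_neg]
    refine h1.unique ?_
    refine h3.congr_fun fun n ↦ ?_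
    rcases eq_or_ne n 0 with rfl | hn
    · simp [a, P]
    · simp [a, P, hn, LSeries.term_of_ne_zero, mul_div_assoc]
  have hU : IsPreconnected {s : ℂ | -1 < s.re} := (convex_halfSpace_re_gt (-1)).isPreconnected
  have hUo : IsOpen {s : ℂ | -1 < s.re} := isOpen_lt continuous_const Complex.continuous_re
  have hf : AnalyticOnNhd ℂ (fun s ↦ s * mellin ψ s) {s : ℂ | -1 < s.re} :=
    DifferentiableOn.analyticOnNhd (fun s hs ↦
      (differentiableAt_id.mul (hmel s hs)).differentiableWithinAt) hUo
  have hg : AnalyticOnNhd ℂ (fun s ↦ Complex.Gamma (s + 1) *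
      (DirichletCharacter.LFunction χ s - c)) {s : ℂ | -1 < s.re} := by
    refine DifferentiableOn.analyticOnNhd
      (fun s hs ↦ DifferentiableAt.differentiableWithinAt ?_) hUo
    refine DifferentiableAt.mul ?_ ((DirichletCharacter.differentiable_LFunction hχ s).sub_const c)
    refine DifferentiableAt.comp (g := Complex.Gamma) s
      (Complex.differentiableAt_Gamma (s + 1) fun m h ↦ ?_) (by fun_prop)
    have h1 := congrArg Complex.re h
    simp only [add_re, one_re, neg_re, natCast_re] at h1
    have h2 : -1 < s.re := hs
    have h3 : (0 : ℝ) ≤ m := m.cast_nonneg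
    linarith
  have heq : (fun s ↦ s * mellin ψ s) =ᶠ[𝓝 2] fun s ↦ Complex.Gamma (s + 1) *
      (DirichletCharacter.LFunction χ s - c) := by
    have : ∀ᶠ s : ℂ in 𝓝 2, 1 < s.re :=
      (isOpen_lt continuous_const Complex.continuous_re).mem_nhds (by simp)
    filter_upwards [this] with s hs
    have hs0 : s ≠ 0 := by rintro rfl; simp at hs; linarith
    rw [key s hs, Complex.Gamma_add_one s hs0]
    ring
  have h0 := hf.eqOn_of_preconnected_of_eventuallyEq hg hU (z₀ := 2) (by simp; norm_num) heq
    (show (0 : ℂ) ∈ {s : ℂ | -1 < s.re} by simp)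
  simpa [sub_eq_zero] using h0.symm

/-! ### Inverting the Stickelberger element -/

/-- The odd Bernoulli function `1/2 - j/p` on the nonzero residue classes. -/
def bernoulliRes (p : ℕ) (j : ZMod p) : ℂ := 1 / 2 - (j.val : ℂ) / p

lemma lambertSum_neg {p : ℕ} [NeZero p] {j : ZMod p} (hj : j ≠ 0) (τ : ℍ) :
    lambertSum p τ (p - j.val) = lambertSum p τ (-j).val := by
  rw [ZMod.neg_val, if_neg hj]

lemma eisensteinPart_neg {p : ℕ} [NeZero p] {j : ZMod p} (hj : j ≠ 0) (τ : ℍ) :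
    eisensteinPart p (-j) τ = -eisensteinPart p j τ := by
  have hp' : (p : ℂ) ≠ 0 := by exact_mod_cast NeZero.ne p
  rw [eisensteinPart, eisensteinPart, lambertSum_neg hj, lambertSum_neg (neg_ne_zero.mpr hj),
    neg_neg, ZMod.neg_val, if_neg hj, Nat.cast_sub (ZMod.val_lt j).le]
  field_simp
  ring

lemma summable_lambert (χ : ℕ → ℂ) (hχ : ∀ n, ‖χ n‖ ≤ 1) (τ : ℍ) :
    Summable fun n : ℕ ↦ χ n * (nome τ ^ n / (1 - nome τ ^ n)) := by
  have hq := norm_nome_lt_one τ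
  have h1 : Tendsto (fun n : ℕ ↦ (1 - nome τ ^ n)⁻¹) cofinite (𝓝 (1 - 0)⁻¹) := by
    rw [Nat.cofinite_eq_atTop]
    exact ((tendsto_pow_atTop_nhds_zero_of_norm_lt_one hq).const_sub 1).inv₀ (by simp)
  have h2 : Summable fun n : ℕ ↦ ‖χ n * nome τ ^ n‖ := by
    refine Summable.of_nonneg_of_le (fun _ ↦ norm_nonneg _) (fun n ↦ ?_)
      (summable_geometric_of_lt_one (norm_nonneg _) hq)
    rw [norm_mul, norm_pow]
    exact mul_le_of_le_one_left (by positivity) (hχ n)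
  exact (h2.mul_tendsto_const h1).congr fun n ↦ by ring

lemma tsum_character_lambert {p : ℕ} [NeZero p] (hp : 1 < p) (χ : DirichletCharacter ℂ p) (τ : ℍ) :
    ∑' n : ℕ+, χ ((n : ℕ) : ZMod p) * (((n : ℕ) : ℂ) ^ (1 - 1) * nome τ ^ (n : ℕ) /
      (1 - nome τ ^ (n : ℕ))) = ∑ j : ZMod p, χ j * lambertSum p τ j.val := by
  have : Fact (1 < p) := ⟨hp⟩
  have hχ0 : χ 0 = 0 := χ.map_nonunit not_isUnit_zero
  let f (n : ℕ) : ℂ := χ n * (nome τ ^ n / (1 - nome τ ^ n))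
  have hf : Summable f := summable_lambert (fun n ↦ χ n) (fun n ↦ χ.norm_le_one _) τ
  have h1 : ∑' n : ℕ+, χ ((n : ℕ) : ZMod p) * (((n : ℕ) : ℂ) ^ (1 - 1) * nome τ ^ (n : ℕ) /
      (1 - nome τ ^ (n : ℕ))) = ∑' n : ℕ, f n := by
    have hf0 : f 0 = 0 := by simp [f, hχ0]
    rw [hf.tsum_eq_zero_add, hf0, zero_add, ← tsum_pnat_eq_tsum_succ (f := f)]
    simp [f]
  rw [h1, Nat.sumByResidueClasses hf p]
  refine Finset.sum_congr rfl fun j _ ↦ ?_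
  rw [lambertSum, ← tsum_mul_left]
  refine tsum_congr fun m ↦ ?_
  simp [f]

lemma odd_and_isPrimitive_iff {p : ℕ} (hp : p.Prime) (χ : DirichletCharacter ℂ p) :
    χ.Odd ∧ χ.IsPrimitive ↔ χ.Odd := by
  refine ⟨And.left, fun h ↦ ⟨h, ?_⟩⟩
  have : NeZero p := ⟨hp.ne_zero⟩
  rw [DirichletCharacter.isPrimitive_def]
  refine ((Nat.dvd_prime hp).mp χ.conductor_dvd_level).resolve_left fun h1 ↦ ?_
  rw [(DirichletCharacter.eq_one_iff_conductor_eq_one).mpr h1] at h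
  rw [DirichletCharacter.Odd, MulChar.one_apply (isUnit_one.neg)] at h
  exact absurd h (by norm_num)

open Classical in
/-- Orthogonality restricted to the odd characters. -/
lemma sum_odd_character {p : ℕ} [NeZero p] (hp : p.Prime) (u : ZMod p) :
    ∑ χ : DirichletCharacter ℂ p with χ.Odd, χ u =
      ((p : ℂ) - 1) / 2 * ((if u = 1 then 1 else 0) - if u = -1 then 1 else 0) := by
  have h1 (χ : DirichletCharacter ℂ p) :
      (if χ.Odd then χ u else 0) = 1 / 2 * (χ u - χ (-u)) := by
    rcases χ.even_or_odd with h | h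
    · have h' : ¬χ.Odd := fun h2 ↦ by
        rw [DirichletCharacter.Odd, h] at h2; norm_num at h2
      rw [if_neg h', h.eval_neg]; ring
    · rw [if_pos h, h.eval_neg]; ring
  rw [Finset.sum_filter, Finset.sum_congr rfl fun χ _ ↦ h1 χ, ← Finset.mul_sum,
    Finset.sum_sub_distrib, DirichletCharacter.sum_characters_eq,
    DirichletCharacter.sum_characters_eq,
    Nat.totient_prime hp, Nat.cast_sub hp.one_le]
  simp only [neg_eq_iff_eq_neg]
  split_ifs <;> simp <;> ring

/-- If `∑ᵢ β(c Aᵢ)` is `1`, `-1`, `0` according as `c = 1`, `c = -1` or neither, then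
`L(0, χ) ∑ᵢ χ(Aᵢ)⁻¹ = 2` for every odd `χ`. -/
lemma LFunction_zero_mul_sum {p : ℕ} [NeZero p] [Fact p.Prime] (hp2 : 2 < p)
    {ι : Type*} [Fintype ι] {A : ι → ZMod p} (hA : ∀ i, A i ≠ 0)
    (h : ∀ c ≠ 0, ∑ i, bernoulliRes p (c * A i) =
      (if c = 1 then 1 else 0) - if c = -1 then 1 else 0)
    {χ : DirichletCharacter ℂ p} (hχ : χ.Odd) :
    DirichletCharacter.LFunction χ 0 = ∑ j, χ j * bernoulliRes p j ∧
    (∑ j, χ j * bernoulliRes p j) * ∑ i, χ (A i)⁻¹ = 2 := by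
  have hχ1 : χ ≠ 1 := by
    rintro rfl
    rw [DirichletCharacter.Odd, MulChar.one_apply (isUnit_one.neg)] at hχ
    norm_num at hχ
  have hχ0 : χ 0 = 0 := χ.map_nonunit not_isUnit_zero
  constructor
  · rw [LFunction_zero (by lia) hχ1]
    simp only [bernoulliRes, mul_sub, Finset.sum_sub_distrib, ← Finset.sum_mul,
      χ.sum_eq_zero_of_ne_one hχ1, zero_mul, zero_sub]
  · have h1 (i : ι) : (∑ j, χ j * bernoulliRes p j) * χ (A i)⁻¹ =
        ∑ c, χ c * bernoulliRes p (c * A i) := by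
      rw [Finset.sum_mul, ← Equiv.sum_comp (Equiv.mulRight₀ (A i) (hA i))]
      refine Finset.sum_congr rfl fun c _ ↦ ?_
      change χ (c * A i) * bernoulliRes p (c * A i) * _ = _
      rw [mul_right_comm, ← map_mul, mul_inv_cancel_right₀ (hA i)]
    rw [Finset.mul_sum, Finset.sum_congr rfl fun i _ ↦ h1 i, Finset.sum_comm]
    have h2 (c : ZMod p) : ∑ i, χ c * bernoulliRes p (c * A i) =
        χ c * ((if c = 1 then 1 else 0) - if c = -1 then 1 else 0) := by
      rcases eq_or_ne c 0 with rfl | hc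
      · simp [hχ0]
      · rw [← Finset.mul_sum, h c hc]
    rw [Finset.sum_congr rfl fun c _ ↦ h2 c]
    simp only [mul_sub, Finset.sum_sub_distrib, mul_ite, mul_one, mul_zero, Finset.sum_ite_eq',
      Finset.mem_univ, if_true, map_one]
    rw [hχ]
    norm_num

/-- The average `𝓔_p` collapses to a finite sum of Eisenstein series of residue classes as soon as
the Stickelberger-type element `∑ β(c) [c]` has an inverse of the form `∑ᵢ [Aᵢ]` on odd
characters. -/
theorem eisensteinSum_eq {p : ℕ} [NeZero p] [Fact p.Prime] (hp2 : 2 < p)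
    {ι : Type*} [Fintype ι] {A : ι → ZMod p} (hA : ∀ i, A i ≠ 0)
    (h : ∀ c ≠ 0, ∑ i, bernoulliRes p (c * A i) =
      (if c = 1 then 1 else 0) - if c = -1 then 1 else 0) (τ : ℍ) :
    eisensteinSum p τ = ∑ i, eisensteinPart p (A i) τ := by
  classical
  have hp : p.Prime := Fact.out
  have hchar (χ : DirichletCharacter ℂ p) (hχ : χ.Odd) : eisensteinChar 1 χ τ =
      1 / 2 * ∑ i, ∑ j, χ ((A i)⁻¹ * j) * eisensteinPart p j τ := by
    obtain ⟨hL, hK⟩ := LFunction_zero_mul_sum hp2 hA h hχ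
    have hχ0 : χ 0 = 0 := χ.map_nonunit not_isUnit_zero
    have hL0 : DirichletCharacter.LFunction χ 0 ≠ 0 := by
      intro h0
      rw [← hL, h0, zero_mul] at hK
      norm_num at hK
    have hS : ∑ j, χ j * eisensteinPart p j τ = DirichletCharacter.LFunction χ 0 +
        2 * ∑ j, χ j * lambertSum p τ j.val := by
      have h1 : ∑ j, χ j * lambertSum p τ (p - j.val) = -∑ j, χ j * lambertSum p τ j.val := by
        rw [← Equiv.sum_comp (Equiv.neg (ZMod p)), ← Finset.sum_neg_distrib]
        refine Finset.sum_congr rfl fun j _ ↦ ?_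
        rcases eq_or_ne j 0 with rfl | hj
        · simp [hχ0]
        · rw [Equiv.neg_apply, lambertSum_neg (neg_ne_zero.mpr hj), neg_neg, hχ.eval_neg, neg_mul]
      have h2 : ∑ j, χ j * eisensteinPart p j τ = ∑ j, χ j * bernoulliRes p j +
          ∑ j, χ j * lambertSum p τ j.val - ∑ j, χ j * lambertSum p τ (p - j.val) := by
        rw [← Finset.sum_add_distrib, ← Finset.sum_sub_distrib]
        refine Finset.sum_congr rfl fun j _ ↦ ?_
        rw [eisensteinPart, bernoulliRes]
        ring
      rw [h2, h1, hL]
      ring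
    have hmul : ∑ i, ∑ j, χ ((A i)⁻¹ * j) * eisensteinPart p j τ =
        (∑ i, χ (A i)⁻¹) * ∑ j, χ j * eisensteinPart p j τ := by
      rw [Finset.sum_mul]
      refine Finset.sum_congr rfl fun i _ ↦ ?_
      rw [Finset.mul_sum]
      refine Finset.sum_congr rfl fun j _ ↦ ?_
      rw [map_mul, mul_assoc]
    rw [hmul, hS, eisensteinChar, tsum_character_lambert hp.one_lt, Nat.cast_one, sub_self]
    rw [← hL] at hK
    generalize ∑ i, χ (A i)⁻¹ = K at hK ⊢
    field_simp
    linear_combination (-(DirichletCharacter.LFunction χ 0) -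
      2 * ∑ j, χ j * lambertSum p τ j.val) * hK
  have hp1 : (p : ℂ) - 1 ≠ 0 := by
    rw [sub_ne_zero]; exact_mod_cast hp.one_lt.ne'
  rw [eisensteinSum]
  simp only [odd_and_isPrimitive_iff hp]
  rw [Finset.sum_congr rfl fun χ hχ ↦ hchar χ (Finset.mem_filter.mp hχ).2, ← Finset.mul_sum,
    Finset.sum_comm, Finset.mul_sum, Finset.mul_sum]
  refine Finset.sum_congr rfl fun i _ ↦ ?_
  rw [Finset.sum_comm]
  have h1 (j : ZMod p) : ∑ χ : DirichletCharacter ℂ p with χ.Odd,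
      χ ((A i)⁻¹ * j) * eisensteinPart p j τ =
      ((if j = A i then ((p : ℂ) - 1) / 2 * eisensteinPart p j τ else 0) -
        if j = -A i then ((p : ℂ) - 1) / 2 * eisensteinPart p j τ else 0) := by
    rw [← Finset.sum_mul, sum_odd_character hp]
    have e1 : (A i)⁻¹ * j = 1 ↔ j = A i := by
      rw [inv_mul_eq_one₀ (hA i), eq_comm]
    have e2 : (A i)⁻¹ * j = -1 ↔ j = -A i := by
      rw [inv_mul_eq_iff_eq_mul₀ (hA i), mul_neg_one]
    simp only [e1, e2]
    split_ifs <;> ring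
  rw [Finset.sum_congr rfl fun j _ ↦ h1 j, Finset.sum_sub_distrib]
  simp only [Finset.sum_ite_eq', Finset.mem_univ, if_true, eisensteinPart_neg (hA i)]
  field_simp
  ring

/-- The same collapse after a diamond operator. -/
theorem diamond_eisensteinSum {p : ℕ} [NeZero p] [Fact p.Prime] (hp2 : 2 < p) {s : ZMod p}
    {ι : Type*} [Fintype ι] {B : ι → ZMod p} (hs : s ≠ 0) (hB : ∀ i, B i ≠ 0)
    (h : ∀ c ≠ 0, ∑ i, bernoulliRes p (c * (s * B i)) =
      (if c = 1 then 1 else 0) - if c = -1 then 1 else 0)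
    {γ : SL(2, ℤ)} (hγ : γ ∈ Gamma0 p) (hγs : ((γ 1 1 : ℤ) : ZMod p) = s) (τ : ℍ) :
    diamond 1 γ (eisensteinSum p) τ = ∑ i, eisensteinPart p (B i) τ := by
  have hdet : s * ((γ 0 0 : ℤ) : ZMod p) = 1 := by
    have h := γ.det_coe
    rw [Matrix.det_fin_two] at h
    have h2 := congrArg (Int.cast : ℤ → ZMod p) h
    push_cast at h2
    rw [Gamma0_mem.mp hγ, hγs] at h2
    linear_combination h2
  have e (i : ι) : s * B i * ((γ 0 0 : ℤ) : ZMod p) = B i := by linear_combination B i * hdet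
  rw [diamond, eisensteinSum_eq hp2 (fun i ↦ mul_ne_zero hs (hB i)) h, zpow_neg_one]
  rw [Finset.sum_congr rfl fun i _ ↦ eisensteinPart_smul hγ (by rw [e]; exact hB i) τ,
    ← Finset.mul_sum, inv_mul_cancel_left₀ (mul_coe_add_ne_zero γ τ)]
  exact Finset.sum_congr rfl fun i _ ↦ by rw [e]

/-! ### The four-term relation for q-products -/

/-- The product `(q^n, q^{p-n}; q^p)_∞`. -/
def qBracket (p n : ℕ) (τ : ℍ) : ℂ :=
  pochInf (nome τ ^ n) (nome τ ^ p) * pochInf (nome τ ^ (p - n)) (nome τ ^ p)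

lemma norm_nome_pow_lt_one (τ : ℍ) {n : ℕ} (hn : 0 < n) : ‖nome τ ^ n‖ < 1 := by
  rw [norm_pow]; exact pow_lt_one₀ (norm_nonneg _) (norm_nome_lt_one τ) hn.ne'

lemma pochInf_nome_ne_zero (τ : ℍ) {n p : ℕ} (hn : 0 < n) (hp : 0 < p) :
    pochInf (nome τ ^ n) (nome τ ^ p) ≠ 0 :=
  pochInf_ne_zero_of_norm_lt (norm_nome_pow_lt_one τ hp) (norm_nome_pow_lt_one τ hn)

lemma qBracket_ne_zero {p n : ℕ} (hn : 0 < n) (hnp : n < p) (τ : ℍ) : qBracket p n τ ≠ 0 :=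
  mul_ne_zero (pochInf_nome_ne_zero τ hn (hn.trans hnp))
    (pochInf_nome_ne_zero τ (by lia) (hn.trans hnp))

lemma qBracket_sub {p n : ℕ} (hnp : n ≤ p) (τ : ℍ) : qBracket p (p - n) τ = qBracket p n τ := by
  rw [qBracket, qBracket, Nat.sub_sub_self hnp, mul_comm]

lemma oddTheta_eq_qBracket {p n : ℕ} (hnp : n < p) (τ : ℍ) :
    oddTheta (-(n * τ)) (p * τ) = pochInf (nome τ ^ p) (nome τ ^ p) *
      (cexp (-(π * Complex.I * (n * τ))) * qBracket p n τ) := by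
  have e1 : cexp (2 * π * Complex.I * (-(n * τ) + p * τ)) = nome τ ^ (p - n) := by
    rw [nome_pow_eq_cexp, Nat.cast_sub hnp.le]; congr 1; ring
  rw [oddTheta_eq_pochInf _ (natCast_mul_im_pos (by lia) τ), e1, neg_neg, ← nome_pow_eq_cexp,
    ← nome_pow_eq_cexp, qBracket, mul_neg]
  ring

lemma oddTheta_ne_zero_of_lt {p n : ℕ} (hn : 0 < n) (hnp : n < p) (τ : ℍ) :
    oddTheta (-(n * τ)) (p * τ) ≠ 0 := by
  rw [oddTheta_eq_qBracket hnp]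
  exact mul_ne_zero (pochInf_nome_ne_zero τ (by lia) (by lia))
    (mul_ne_zero (exp_ne_zero _) (qBracket_ne_zero hn hnp τ))

lemma oddTheta_add_period {p m : ℕ} (hp : 0 < p) (τ : ℍ) :
    oddTheta (-((p + m : ℕ) * τ)) (p * τ) =
      -(cexp (-(π * Complex.I * (p * τ))) * cexp (-(2 * π * Complex.I * (m * τ))) *
        oddTheta (-(m * τ)) (p * τ)) := by
  have hτ := natCast_mul_im_pos hp τ
  rw [oddTheta_neg _ hτ, oddTheta_neg _ hτ, Nat.cast_add,
    show ((p : ℂ) + m) * (τ : ℂ) = m * τ + p * τ by ring, oddTheta_add_self_left]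
  simp only [neg_mul]
  ring

lemma eisensteinPart_eq_logDeriv {p n : ℕ} [NeZero p] (hn : (n : ZMod p) ≠ 0) (τ : ℍ)
    (h0 : oddTheta (-(n * τ)) (p * τ) ≠ 0) :
    2 * π * Complex.I * eisensteinPart p n τ =
      logDeriv (oddTheta · (p * τ)) (-(n * τ)) - 2 * π * Complex.I * (n / p) := by
  have hp' : (p : ℂ) ≠ 0 := by exact_mod_cast NeZero.ne p
  have e : -(n : ℂ) / p * (p * τ) + 0 = -(n * τ) := by field_simp; ring
  rw [← eisensteinPart_eq_heckeZ hn (n := n) (by simp) 0 τ, heckeZ, Int.cast_natCast, Int.cast_zero,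
    e, if_neg h0]
  ring

lemma natCast_ne_zero_of_lt {p n : ℕ} (hn : 0 < n) (hnp : n < p) : (n : ZMod p) ≠ 0 := by
  rw [Ne, ZMod.natCast_eq_zero_iff]
  exact Nat.not_dvd_of_pos_of_lt hn hnp

/-- The four-term relation at the points `-b₁τ, -b₂τ, -b₃τ` for the lattice `ℤpτ + ℤ`. -/
lemma eisensteinPart_add_sub {p b₁ b₂ b₃ : ℕ} [NeZero p] (h₁ : 0 < b₁) (h₂ : 0 < b₂) (h₃ : 0 < b₃)
    (h₁₂ : b₁ + b₂ < p) (h₂₃ : b₂ + b₃ < p)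
    (hN : ((b₁ + b₂ + b₃ : ℕ) : ZMod p) ≠ 0) (τ : ℍ)
    (hθ : oddTheta (-((b₁ + b₂ + b₃ : ℕ) * τ)) (p * τ) ≠ 0) :
    eisensteinPart p b₁ τ + eisensteinPart p b₂ τ + eisensteinPart p b₃ τ -
      eisensteinPart p (b₁ + b₂ + b₃ : ℕ) τ = pochInf (nome τ ^ p) (nome τ ^ p) ^ 3 *
      (oddTheta (-((b₁ + b₂ : ℕ) * τ)) (p * τ) * oddTheta (-((b₂ + b₃ : ℕ) * τ)) (p * τ) *
        oddTheta (-((b₁ + b₃ : ℕ) * τ)) (p * τ)) /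
      (oddTheta (-(b₁ * τ)) (p * τ) * oddTheta (-(b₂ * τ)) (p * τ) *
        oddTheta (-(b₃ * τ)) (p * τ) * oddTheta (-((b₁ + b₂ + b₃ : ℕ) * τ)) (p * τ)) := by
  have hτ := natCast_mul_im_pos (Nat.pos_of_ne_zero (NeZero.ne p)) τ
  have t₁ := oddTheta_ne_zero_of_lt h₁ (show b₁ < p by lia) τ
  have t₂ := oddTheta_ne_zero_of_lt h₂ (show b₂ < p by lia) τ
  have t₃ := oddTheta_ne_zero_of_lt h₃ (show b₃ < p by lia) τ
  have e₁ := eisensteinPart_eq_logDeriv (natCast_ne_zero_of_lt h₁ (show b₁ < p by lia)) τ t₁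
  have e₂ := eisensteinPart_eq_logDeriv (natCast_ne_zero_of_lt h₂ (show b₂ < p by lia)) τ t₂
  have e₃ := eisensteinPart_eq_logDeriv (natCast_ne_zero_of_lt h₃ (show b₃ < p by lia)) τ t₃
  have e₄ := eisensteinPart_eq_logDeriv hN τ hθ
  have s₁₂ : -(((b₁ + b₂ : ℕ) : ℂ) * (τ : ℂ)) = -(b₁ * τ) + -(b₂ * τ) := by push_cast; ring
  have s₂₃ : -(((b₂ + b₃ : ℕ) : ℂ) * (τ : ℂ)) = -(b₂ * τ) + -(b₃ * τ) := by push_cast; ring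
  have s₁₃ : -(((b₁ + b₃ : ℕ) : ℂ) * (τ : ℂ)) = -(b₁ * τ) + -(b₃ * τ) := by push_cast; ring
  have s₁₂₃ : -(((b₁ + b₂ + b₃ : ℕ) : ℂ) * (τ : ℂ)) = -(b₁ * τ) + -(b₂ * τ) + -(b₃ * τ) := by
    push_cast; ring
  have key := logDeriv_oddTheta_add_sub hτ t₁ t₂ t₃ (by rwa [← s₁₂₃])
  rw [← s₁₂₃, ← s₁₂, ← s₂₃, ← s₁₃, deriv_oddTheta_zero hτ, ← nome_pow_eq_cexp] at key
  refine mul_left_cancel₀ two_pi_I_ne_zero ?_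
  have hc : ((b₁ + b₂ + b₃ : ℕ) : ℂ) = b₁ + b₂ + b₃ := by push_cast; ring
  linear_combination e₁ + e₂ + e₃ - e₄ + key + 2 * π * Complex.I / p * hc

lemma eisensteinPart_add_sub_of_lt {p b₁ b₂ b₃ : ℕ} [NeZero p] (h₁ : 0 < b₁) (h₂ : 0 < b₂)
    (h₃ : 0 < b₃) (hN : b₁ + b₂ + b₃ < p) (τ : ℍ) :
    eisensteinPart p b₁ τ + eisensteinPart p b₂ τ + eisensteinPart p b₃ τ -
      eisensteinPart p (b₁ + b₂ + b₃ : ℕ) τ = pochInf (nome τ ^ p) (nome τ ^ p) ^ 2 *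
      (qBracket p (b₁ + b₂) τ * qBracket p (b₂ + b₃) τ * qBracket p (b₁ + b₃) τ) /
      (qBracket p b₁ τ * qBracket p b₂ τ * qBracket p b₃ τ * qBracket p (b₁ + b₂ + b₃) τ) := by
  have hN0 : 0 < b₁ + b₂ + b₃ := by lia
  rw [eisensteinPart_add_sub h₁ h₂ h₃ (by lia) (by lia) (natCast_ne_zero_of_lt hN0 hN) τ
    (oddTheta_ne_zero_of_lt hN0 hN τ), oddTheta_eq_qBracket (show b₁ + b₂ < p by lia),
    oddTheta_eq_qBracket (show b₂ + b₃ < p by lia), oddTheta_eq_qBracket (show b₁ + b₃ < p by lia),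
    oddTheta_eq_qBracket (show b₁ < p by lia), oddTheta_eq_qBracket (show b₂ < p by lia),
    oddTheta_eq_qBracket (show b₃ < p by lia), oddTheta_eq_qBracket hN]
  have n₁ := qBracket_ne_zero h₁ (show b₁ < p by lia) τ
  have n₂ := qBracket_ne_zero h₂ (show b₂ < p by lia) τ
  have n₃ := qBracket_ne_zero h₃ (show b₃ < p by lia) τ
  have n₄ := qBracket_ne_zero hN0 hN τ
  have hE := pochInf_nome_ne_zero τ (show 0 < p by lia) (show 0 < p by lia)
  have hexp : cexp (-(π * Complex.I * ((b₁ + b₂ : ℕ) * τ))) *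
      cexp (-(π * Complex.I * ((b₂ + b₃ : ℕ) * τ))) *
      cexp (-(π * Complex.I * ((b₁ + b₃ : ℕ) * τ))) =
      cexp (-(π * Complex.I * (b₁ * τ))) * cexp (-(π * Complex.I * (b₂ * τ))) *
      cexp (-(π * Complex.I * (b₃ * τ))) * cexp (-(π * Complex.I * ((b₁ + b₂ + b₃ : ℕ) * τ))) := by
    simp only [← exp_add]; congr 1; push_cast; ring
  have hne (x : ℂ) := exp_ne_zero x
  rw [div_eq_div_iff (by simp [*]) (by simp [*])]
  linear_combination (pochInf (nome τ ^ p) (nome τ ^ p) ^ 6 * (qBracket p (b₁ + b₂) τ *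
    qBracket p (b₂ + b₃) τ * qBracket p (b₁ + b₃) τ) * (qBracket p b₁ τ * qBracket p b₂ τ *
    qBracket p b₃ τ * qBracket p (b₁ + b₂ + b₃) τ)) * hexp

lemma eisensteinPart_add_sub_of_eq_add {p b₁ b₂ b₃ m : ℕ} [NeZero p] (h₁ : 0 < b₁) (h₂ : 0 < b₂)
    (h₃ : 0 < b₃) (h₁₂ : b₁ + b₂ < p) (h₂₃ : b₂ + b₃ < p) (h₁₃ : b₁ + b₃ < p)
    (hm : 0 < m) (hN : b₁ + b₂ + b₃ = p + m) (τ : ℍ) :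
    eisensteinPart p b₁ τ + eisensteinPart p b₂ τ + eisensteinPart p b₃ τ -
      eisensteinPart p m τ = -(nome τ ^ m * pochInf (nome τ ^ p) (nome τ ^ p) ^ 2 *
      (qBracket p (b₁ + b₂) τ * qBracket p (b₂ + b₃) τ * qBracket p (b₁ + b₃) τ) /
      (qBracket p b₁ τ * qBracket p b₂ τ * qBracket p b₃ τ * qBracket p m τ)) := by
  have hp : 0 < p := by lia
  have hmp : m < p := by lia
  have hcast : ((b₁ + b₂ + b₃ : ℕ) : ZMod p) = m := by rw [hN]; simp
  have hθ : oddTheta (-((b₁ + b₂ + b₃ : ℕ) * τ)) (p * τ) ≠ 0 := by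
    rw [hN, oddTheta_add_period hp]
    exact neg_ne_zero.mpr (mul_ne_zero (mul_ne_zero (exp_ne_zero _) (exp_ne_zero _))
      (oddTheta_ne_zero_of_lt hm hmp τ))
  rw [← hcast, eisensteinPart_add_sub h₁ h₂ h₃ h₁₂ h₂₃
    (by rw [hcast]; exact natCast_ne_zero_of_lt hm hmp) τ hθ, hN, oddTheta_add_period hp,
    oddTheta_eq_qBracket h₁₂, oddTheta_eq_qBracket h₂₃, oddTheta_eq_qBracket h₁₃,
    oddTheta_eq_qBracket (show b₁ < p by lia), oddTheta_eq_qBracket (show b₂ < p by lia),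
    oddTheta_eq_qBracket (show b₃ < p by lia), oddTheta_eq_qBracket hmp]
  have n₁ := qBracket_ne_zero h₁ (show b₁ < p by lia) τ
  have n₂ := qBracket_ne_zero h₂ (show b₂ < p by lia) τ
  have n₃ := qBracket_ne_zero h₃ (show b₃ < p by lia) τ
  have n₄ := qBracket_ne_zero hm hmp τ
  have hE := pochInf_nome_ne_zero τ hp hp
  have hN' : (b₁ : ℂ) + b₂ + b₃ = p + m := by exact_mod_cast hN
  have hexp : cexp (-(π * Complex.I * ((b₁ + b₂ : ℕ) * τ))) *
      cexp (-(π * Complex.I * ((b₂ + b₃ : ℕ) * τ))) *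
      cexp (-(π * Complex.I * ((b₁ + b₃ : ℕ) * τ))) =
      nome τ ^ m * (cexp (-(π * Complex.I * (b₁ * τ))) * cexp (-(π * Complex.I * (b₂ * τ))) *
      cexp (-(π * Complex.I * (b₃ * τ))) * (cexp (-(π * Complex.I * (p * τ))) *
      cexp (-(2 * π * Complex.I * (m * τ))) * cexp (-(π * Complex.I * (m * τ))))) := by
    rw [nome_pow_eq_cexp]
    simp only [← exp_add]; congr 1; push_cast
    linear_combination (-(π * Complex.I * τ)) * hN'
  have hne (x : ℂ) := exp_ne_zero x
  rw [← neg_div, div_eq_div_iff (by simp [*]) (by simp [*])]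
  linear_combination (pochInf (nome τ ^ p) (nome τ ^ p) ^ 6 * (qBracket p (b₁ + b₂) τ *
    qBracket p (b₂ + b₃) τ * qBracket p (b₁ + b₃) τ) * (qBracket p b₁ τ * qBracket p b₂ τ *
    qBracket p b₃ τ * qBracket p m τ)) * hexp

/-! ### Theta quotients as q-products -/

/-- Up to a power of `q` and a root of unity, `φ_{p,j+1}` is `(q^p; q^p)_∞` times the product
`(q^n, q^{p-n}; q^p)_∞` with `n = (p - 1) / 2 - j`. -/
lemma phi_eq_qBracket {p j : ℕ} (hp : Odd p) (hj : j < (p - 1) / 2) (τ : ℍ) :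
    phi p (j + 1) τ = cexp (π * Complex.I * (2 * j + 1) / (2 * p)) *
      cexp (2 * π * Complex.I * (τ / (8 * p))) ^ ((2 * j + 1) ^ 2) *
      (pochInf (nome τ ^ p) (nome τ ^ p) * qBracket p ((p - 1) / 2 - j) τ) := by
  obtain ⟨h, rfl⟩ := hp
  have hh : (2 * h + 1 - 1) / 2 = h := by lia
  rw [hh] at hj ⊢
  obtain ⟨d, rfl⟩ : ∃ d, h = j + 1 + d := ⟨h - j - 1, by lia⟩
  set p := 2 * (j + 1 + d) + 1 with hpdef
  have hp0 : (p : ℂ) ≠ 0 := by exact_mod_cast (show p ≠ 0 by lia)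
  have hpc : (p : ℂ) = 2 * (j + 1 + d) + 1 := by rw [hpdef]; push_cast; ring
  have key : phi p (j + 1) τ = cexp (π * Complex.I * (2 * j + 1) / (2 * p)) *
      cexp (2 * π * Complex.I * (τ / (8 * p))) ^ ((2 * j + 1) ^ 2) *
      jacobiTheta₂ ((2 * j + 1) * τ / 2 + 1 / 2) (p * τ) := by
    rw [phi, thetaChar, jacobiTheta₂, ← tsum_mul_left]
    refine tsum_congr fun n => ?_
    rw [jacobiTheta₂_term, ← exp_nat_mul, ← exp_add, ← exp_add]
    congr 1
    push_cast
    field_simp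
    ring
  have e1 : -cexp (2 * π * Complex.I * ((2 * j + 1) * τ / 2 + 1 / 2 + p * τ / 2)) =
      nome τ ^ (p - (j + 1 + d - j)) := by
    rw [nome_pow_eq_cexp, show p - (j + 1 + d - j) = 2 * j + d + 2 by lia,
      show 2 * π * Complex.I * ((2 * j + 1) * τ / 2 + 1 / 2 + p * τ / 2) =
        2 * π * Complex.I * ((2 * j + d + 2 : ℕ) * τ) + π * Complex.I by
          rw [hpc]; push_cast; ring, exp_add, exp_pi_mul_I]
    ring
  have e2 : -cexp (2 * π * Complex.I * (-((2 * j + 1) * τ / 2 + 1 / 2) + p * τ / 2)) =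
      nome τ ^ (j + 1 + d - j) := by
    rw [nome_pow_eq_cexp, show j + 1 + d - j = d + 1 by lia,
      show 2 * π * Complex.I * (-((2 * j + 1) * τ / 2 + 1 / 2) + p * τ / 2) =
        2 * π * Complex.I * ((d + 1 : ℕ) * τ) - π * Complex.I by
          rw [hpc]; push_cast; ring, exp_sub, exp_pi_mul_I]
    ring
  rw [key, jacobiTheta₂_eq_pochInf _ (natCast_mul_im_pos (by lia) τ), e1, e2, ← nome_pow_eq_cexp,
    qBracket]
  ring

lemma eta_cube_eq (p : ℕ) (hp : 0 < p) (τ : ℍ) :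
    ModularForm.eta ((p : ℂ) * (τ : ℂ)) ^ 3 =
      cexp (2 * π * Complex.I * (τ / (8 * p))) ^ (p ^ 2) *
        pochInf (nome τ ^ p) (nome τ ^ p) ^ 3 := by
  have hp0 : (p : ℂ) ≠ 0 := by exact_mod_cast hp.ne'
  have e : ∀ n, ModularForm.eta_q n ((p : ℂ) * τ) = nome τ ^ p * (nome τ ^ p) ^ n := by
    intro n
    rw [ModularForm.eta_q_eq_pow, ← nome_pow_eq_cexp, pow_succ']
  rw [ModularForm.eta, pochInf]
  simp only [e]
  rw [mul_pow, Function.Periodic.qParam, ← exp_nat_mul, ← exp_nat_mul]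
  congr 2
  push_cast
  field_simp
  ring

/-- For an odd `p`, the theta quotient as a `q`-product. The hypotheses say that the product has
weight one and order `m` at infinity. -/
lemma thetaQuot_eq {p m : ℕ} {b : Fin ((p - 1) / 2) → ℤ} (hp : Odd p) (hb : ∑ j, b j = -1)
    (hm : (p : ℤ) ^ 2 + ∑ j : Fin ((p - 1) / 2), b j * (2 * (j : ℕ) + 1) ^ 2 = 8 * p * m) (τ : ℍ) :
    thetaQuot p b τ = nome τ ^ m * pochInf (nome τ ^ p) (nome τ ^ p) ^ 2 *
      ∏ j : Fin ((p - 1) / 2), qBracket p ((p - 1) / 2 - j) τ ^ b j := by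
  have hp0 : 0 < p := hp.pos
  set r := cexp (2 * π * Complex.I * (τ / (8 * p))) with hr
  set E := pochInf (nome τ ^ p) (nome τ ^ p)
  have hr0 : r ≠ 0 := exp_ne_zero _
  have hE : E ≠ 0 := pochInf_nome_ne_zero τ hp0 hp0
  have hrn : nome τ ^ m = r ^ (8 * p * m) := by
    have : (p : ℂ) ≠ 0 := by exact_mod_cast hp0.ne'
    rw [nome_pow_eq_cexp, hr, ← exp_nat_mul]
    congr 1; push_cast; field_simp
  have hf (j : Fin ((p - 1) / 2)) :
      cexp (-(π * Complex.I * (b j : ℂ) * (2 * ((j : ℕ) + 1 : ℂ) - 1) / (2 * (p : ℂ)))) *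
        phi p ((j : ℕ) + 1) τ ^ b j =
      r ^ (b j * (2 * (j : ℕ) + 1) ^ 2) * E ^ b j * qBracket p ((p - 1) / 2 - j) τ ^ b j := by
    have he : cexp (-(π * Complex.I * (b j : ℂ) * (2 * ((j : ℕ) + 1 : ℂ) - 1) / (2 * (p : ℂ)))) *
        cexp (π * Complex.I * (2 * (j : ℕ) + 1) / (2 * p)) ^ b j = 1 := by
      rw [← exp_int_mul, ← exp_add, ← exp_zero]
      congr 1; ring
    have hr : r ^ (b j * (2 * (j : ℕ) + 1) ^ 2) = (r ^ ((2 * (j : ℕ) + 1) ^ 2)) ^ b j := by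
      rw [← zpow_natCast, ← zpow_mul, mul_comm]; push_cast; rfl
    rw [phi_eq_qBracket hp j.2, mul_zpow, mul_zpow, mul_zpow, hr]
    linear_combination (r ^ ((2 * (j : ℕ) + 1) ^ 2)) ^ b j * E ^ b j *
      qBracket p ((p - 1) / 2 - j) τ ^ b j * he
  have hprod {x : ℂ} (hx : x ≠ 0) (g : Fin ((p - 1) / 2) → ℤ) : ∏ j, x ^ g j = x ^ ∑ j, g j := by
    induction (Finset.univ : Finset (Fin ((p - 1) / 2))) using Finset.induction_on with
    | empty => simp
    | insert a s ha ih => rw [Finset.prod_insert ha, Finset.sum_insert ha, zpow_add₀ hx, ih]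
  rw [thetaQuot, Finset.prod_congr rfl fun j _ => hf j, Finset.prod_mul_distrib,
    Finset.prod_mul_distrib, hprod hr0, hprod hE, hb, eta_cube_eq p hp0, hrn]
  have h1 : r ^ (8 * p * m) = r ^ p ^ 2 *
      r ^ (∑ j : Fin ((p - 1) / 2), b j * (2 * (j : ℕ) + 1) ^ 2) := by
    rw [← zpow_natCast, ← zpow_natCast, ← zpow_add₀ hr0]
    congr 1; push_cast; exact hm.symm
  rw [h1, zpow_neg_one, ← hr]
  change r ^ p ^ 2 * E ^ 3 * _ = _
  field_simp

/-- The exponent of `qBracket p ((p - 1) / 2 - j)` in `qBracket p n`: one if `n` is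
`± ((p - 1) / 2 - j)` modulo `p`, and zero otherwise. -/
def bracketExp (p n j : ℕ) : ℤ :=
  if (p - 1) / 2 - j = n ∨ (p - 1) / 2 - j = p - n then 1 else 0

lemma prod_qBracket_zpow {p n : ℕ} (hp : Odd p) (hn : 0 < n) (hnp : n < p) (τ : ℍ) :
    ∏ j : Fin ((p - 1) / 2), qBracket p ((p - 1) / 2 - j) τ ^ bracketExp p n j =
      qBracket p n τ := by
  obtain ⟨h, rfl⟩ := hp
  have hh : (2 * h + 1 - 1) / 2 = h := by lia
  obtain ⟨j, hj, hjn⟩ : ∃ j < (2 * h + 1 - 1) / 2, (2 * h + 1 - 1) / 2 - j = n ∨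
      (2 * h + 1 - 1) / 2 - j = 2 * h + 1 - n := by
    rcases le_or_gt n h with hc | hc
    · exact ⟨h - n, by lia, by lia⟩
    · exact ⟨n - h - 1, by lia, by lia⟩
  rw [Finset.prod_eq_single ⟨j, hj⟩]
  · rw [bracketExp, if_pos hjn, zpow_one]
    rcases hjn with e | e
    · rw [e]
    · rw [e, qBracket_sub hnp.le]
  · rintro ⟨i, hi⟩ - hne
    rw [bracketExp, if_neg, zpow_zero]
    rintro e
    exact hne (Fin.ext (show i = j by lia))
  · simp

lemma qPoch_append (N : ℕ) (l₁ l₂ : List ℕ) (τ : ℍ) :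
    qPoch N (l₁ ++ l₂) τ = qPoch N l₁ τ * qPoch N l₂ τ := by
  simp [qPoch]

lemma prod_qBracket_zpow_list {p : ℕ} (hp : Odd p) {l : List ℕ} (hl : ∀ n ∈ l, 0 < n ∧ n < p)
    (τ : ℍ) :
    ∏ j : Fin ((p - 1) / 2), qBracket p ((p - 1) / 2 - j) τ ^ (l.map (bracketExp p · j)).sum =
      qPoch p (l.flatMap fun n ↦ [n, p - n]) τ := by
  induction l with
  | nil => simp [qPoch]
  | cons n l ih =>
    have h0 (j : Fin ((p - 1) / 2)) : qBracket p ((p - 1) / 2 - j) τ ≠ 0 :=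
      qBracket_ne_zero (by lia) (by lia) τ
    simp only [List.map_cons, List.sum_cons, zpow_add₀ (h0 _), Finset.prod_mul_distrib,
      List.flatMap_cons, qPoch_append]
    rw [ih fun k hk ↦ hl k (List.mem_cons_of_mem _ hk),
      prod_qBracket_zpow hp (hl n List.mem_cons_self).1 (hl n List.mem_cons_self).2]
    simp [qPoch, qBracket]

/-- The theta quotient as a `q`-product, when the exponents `b` are those of a quotient of products
`(q^n, q^{p-n}; q^p)_∞`, with `n` in the list `N` for the numerator and `D` for the denominator. -/
theorem thetaQuot_eq_qPoch {p m : ℕ} {N D : List ℕ} {b : Fin ((p - 1) / 2) → ℤ}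
    (h : Odd p ∧ (∀ n ∈ N, 0 < n ∧ n < p) ∧ (∀ n ∈ D, 0 < n ∧ n < p) ∧
      (∀ j : Fin ((p - 1) / 2), b j =
        (N.map (bracketExp p · j)).sum - (D.map (bracketExp p · j)).sum) ∧ ∑ j, b j = -1 ∧
      (p : ℤ) ^ 2 + ∑ j : Fin ((p - 1) / 2), b j * (2 * (j : ℕ) + 1) ^ 2 = 8 * p * m) (τ : ℍ) :
    thetaQuot p b τ = nome τ ^ m * qPoch p ((N.flatMap fun n ↦ [n, p - n]) ++ [p, p]) τ /
      qPoch p (D.flatMap fun n ↦ [n, p - n]) τ := by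
  obtain ⟨hp, hN, hD, hb, hsum, hm⟩ := h
  have h0 (j : Fin ((p - 1) / 2)) : qBracket p ((p - 1) / 2 - j) τ ≠ 0 :=
    qBracket_ne_zero (by lia) (by lia) τ
  rw [thetaQuot_eq hp hsum hm, qPoch_append]
  simp only [hb, zpow_sub₀ (h0 _), Finset.prod_div_distrib]
  rw [prod_qBracket_zpow_list hp hN, prod_qBracket_zpow_list hp hD]
  simp only [qPoch, List.map_cons, List.map_nil, List.prod_cons, List.prod_nil]
  ring

/-- Splitting `(q; q)_∞` according to residue classes modulo `N`. -/
lemma pochInf_self_eq_prod (N : ℕ) [NeZero N] {q : ℂ} (hq : ‖q‖ < 1) :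
    pochInf q q = ∏ r : Fin N, pochInf (q ^ ((r : ℕ) + 1)) (q ^ N) := by
  have hqN : ‖q ^ N‖ < 1 := by
    rw [norm_pow]; exact pow_lt_one₀ (norm_nonneg _) hq (NeZero.ne N)
  have h1 := ((Nat.divModEquiv N).trans (Equiv.prodComm _ _)).symm.hasProd_iff.mpr
    (multipliable_pochInf q hq).hasProd
  have h2 := h1.prod_fiberwise (g := fun r : Fin N ↦ pochInf (q ^ ((r : ℕ) + 1)) (q ^ N))
    fun r ↦ by
      refine (multipliable_pochInf _ hqN).hasProd.congr_fun fun k ↦ ?_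
      simp [Nat.divModEquiv]
      ring
  exact (h2.unique (hasProd_fintype _)).symm ▸ rfl

lemma qPoch_one_eq_qPoch_five (τ : ℍ) : qPoch 1 [1] τ = qPoch 5 [1, 2, 3, 4, 5] τ := by
  simp [qPoch, pochInf_self_eq_prod 5 (norm_nome_lt_one τ), Fin.prod_univ_five, mul_assoc]

/-! ### Diamond translates as theta quotients -/

/-- Since `β(j) = 1/2 - j/p`, a sum of four values of `β` equal to `1`, `-1` or `0` is a sum of four
least residues equal to `p`, `3p` or `2p`. -/
lemma sum_bernoulliRes_eq {p s : ℕ} [NeZero p] (hp : 2 < p) {a : Fin 4 → ℕ}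
    (h : ∀ c < p, c ≠ 0 → ∑ i, c * (s * a i) % p =
      if c = 1 then p else if c + 1 = p then 3 * p else 2 * p) (c : ZMod p) (hc : c ≠ 0) :
    ∑ i, bernoulliRes p (c * ((s : ZMod p) * (a i : ℕ))) =
      (if c = 1 then 1 else 0) - if c = -1 then 1 else 0 := by
  obtain ⟨k, hk, rfl⟩ : ∃ k < p, (k : ZMod p) = c := ⟨c.val, c.val_lt, by simp⟩
  have hk0 : k ≠ 0 := by rintro rfl; simp at hc
  have hp0 : (p : ℂ) ≠ 0 := by exact_mod_cast NeZero.ne p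
  have e1 : (k : ZMod p) = 1 ↔ k = 1 := by
    rw [← Nat.cast_one, ZMod.natCast_eq_natCast_iff', Nat.mod_eq_of_lt hk,
      Nat.mod_eq_of_lt (by lia)]
  have e2 : (k : ZMod p) = -1 ↔ k + 1 = p := by
    rw [eq_neg_iff_add_eq_zero, ← Nat.cast_succ, ZMod.natCast_eq_zero_iff]
    exact ⟨fun hd ↦ le_antisymm hk (Nat.le_of_dvd (by lia) hd), fun hd ↦ hd ▸ dvd_rfl⟩
  have e3 : ∑ i, bernoulliRes p (k * ((s : ZMod p) * (a i : ℕ))) =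
      2 - ((∑ i, k * (s * a i) % p : ℕ) : ℂ) / p := by
    simp only [bernoulliRes, ← Nat.cast_mul, ZMod.val_natCast, Finset.sum_sub_distrib,
      Nat.cast_sum, Finset.sum_div]
    simp; norm_num
  rw [e3, h k hk hk0]
  simp only [e1, e2]
  split_ifs <;> first | lia | (push_cast; field_simp; norm_num)

lemma natCast_sub_zmod {p b : ℕ} (hb : b ≤ p) : ((p - b : ℕ) : ZMod p) = -b := by
  rw [Nat.cast_sub hb]; simp

/-- The diamond translate of `𝓔_p` is a theta quotient when
`(-b₁, -b₂, -b₃, m)` inverts the Stickelberger element and `b₁ + b₂ + b₃ = p + m`. -/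
theorem diamondEq_thetaQuot_of_eq_add {p s m : ℕ} (b₁ b₂ b₃ : ℕ) [NeZero p] [Fact p.Prime]
    {b : Fin ((p - 1) / 2) → ℤ}
    (h : (b₁ + b₂ + b₃ = p + m ∧ 0 < m ∧ b₁ + b₂ < p ∧ b₂ + b₃ < p ∧ b₁ + b₃ < p ∧ s % p ≠ 0) ∧
      ∀ c < p, c ≠ 0 → ∑ i, c * (s * ![p - b₁, p - b₂, p - b₃, m] i) % p =
        if c = 1 then p else if c + 1 = p then 3 * p else 2 * p)
    (hb : Odd p ∧ (∀ n ∈ [b₁ + b₂, b₂ + b₃, b₁ + b₃], 0 < n ∧ n < p) ∧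
      (∀ n ∈ [b₁, b₂, b₃, m], 0 < n ∧ n < p) ∧
      (∀ j : Fin ((p - 1) / 2), b j =
        ([b₁ + b₂, b₂ + b₃, b₁ + b₃].map (bracketExp p · j)).sum -
          ([b₁, b₂, b₃, m].map (bracketExp p · j)).sum) ∧ ∑ j, b j = -1 ∧
      (p : ℤ) ^ 2 + ∑ j : Fin ((p - 1) / 2), b j * (2 * (j : ℕ) + 1) ^ 2 = 8 * p * m) :
    DiamondEq p s (thetaQuot p b) := by
  obtain ⟨⟨hm, hm0, h₁₂, h₂₃, h₁₃, hs⟩, hB⟩ := h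
  have hp2 : 2 < p := by lia
  intro γ hγ hγs
  funext τ
  have hs0 : (s : ZMod p) ≠ 0 := by
    rw [Ne, ZMod.natCast_eq_zero_iff]; exact fun hd ↦ hs (Nat.mod_eq_zero_of_dvd hd)
  rw [diamond_eisensteinSum hp2 hs0 (B := fun i ↦ ((![p - b₁, p - b₂, p - b₃, m] i : ℕ) : ZMod p))
    ?_ (sum_bernoulliRes_eq hp2 hB) hγ hγs, thetaQuot_eq_qPoch hb]
  · have key := eisensteinPart_add_sub_of_eq_add (show 0 < b₁ by lia) (show 0 < b₂ by lia)
      (show 0 < b₃ by lia) h₁₂ h₂₃ h₁₃ hm0 hm τ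
    have n₁ := natCast_ne_zero_of_lt (show 0 < b₁ by lia) (show b₁ < p by lia)
    have n₂ := natCast_ne_zero_of_lt (show 0 < b₂ by lia) (show b₂ < p by lia)
    have n₃ := natCast_ne_zero_of_lt (show 0 < b₃ by lia) (show b₃ < p by lia)
    simp only [Fin.sum_univ_four, Matrix.cons_val]
    rw [natCast_sub_zmod (show b₁ ≤ p by lia), natCast_sub_zmod (show b₂ ≤ p by lia),
      natCast_sub_zmod (show b₃ ≤ p by lia), eisensteinPart_neg n₁, eisensteinPart_neg n₂,
      eisensteinPart_neg n₃]
    simp only [qPoch, List.flatMap_cons, List.flatMap_nil, List.cons_append, List.nil_append,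
      List.append_nil, List.map_cons, List.map_nil, List.prod_cons, List.prod_nil]
    simp only [qBracket] at key
    linear_combination -key
  · intro i
    refine natCast_ne_zero_of_lt ?_ ?_ <;> fin_cases i <;> simp <;> lia

/-- The translate `𝓔_p` itself is a theta quotient when `(b₁, b₂, b₃, -(b₁ + b₂ + b₃))` inverts the
Stickelberger element and `b₁ + b₂ + b₃ < p`. -/
theorem diamondEq_thetaQuot_of_lt {p s : ℕ} (b₁ b₂ b₃ : ℕ) [NeZero p] [Fact p.Prime]
    {b : Fin ((p - 1) / 2) → ℤ}
    (h : (b₁ + b₂ + b₃ < p ∧ s % p ≠ 0) ∧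
      ∀ c < p, c ≠ 0 → ∑ i, c * (s * ![b₁, b₂, b₃, p - (b₁ + b₂ + b₃)] i) % p =
        if c = 1 then p else if c + 1 = p then 3 * p else 2 * p)
    (hb : Odd p ∧ (∀ n ∈ [b₁ + b₂, b₂ + b₃, b₁ + b₃], 0 < n ∧ n < p) ∧
      (∀ n ∈ [b₁, b₂, b₃, b₁ + b₂ + b₃], 0 < n ∧ n < p) ∧
      (∀ j : Fin ((p - 1) / 2), b j =
        ([b₁ + b₂, b₂ + b₃, b₁ + b₃].map (bracketExp p · j)).sum -
          ([b₁, b₂, b₃, b₁ + b₂ + b₃].map (bracketExp p · j)).sum) ∧ ∑ j, b j = -1 ∧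
      (p : ℤ) ^ 2 + ∑ j : Fin ((p - 1) / 2), b j * (2 * (j : ℕ) + 1) ^ 2 = 8 * p * (0 : ℕ)) :
    DiamondEq p s (thetaQuot p b) := by
  obtain ⟨⟨hN, hs⟩, hB⟩ := h
  have h₁ : 0 < b₁ := (hb.2.2.1 b₁ (by simp)).1
  have h₂ : 0 < b₂ := (hb.2.2.1 b₂ (by simp)).1
  have h₃ : 0 < b₃ := (hb.2.2.1 b₃ (by simp)).1
  have hp2 : 2 < p := by lia
  intro γ hγ hγs
  funext τ
  have hs0 : (s : ZMod p) ≠ 0 := by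
    rw [Ne, ZMod.natCast_eq_zero_iff]; exact fun hd ↦ hs (Nat.mod_eq_zero_of_dvd hd)
  rw [diamond_eisensteinSum hp2 hs0
    (B := fun i ↦ ((![b₁, b₂, b₃, p - (b₁ + b₂ + b₃)] i : ℕ) : ZMod p))
    ?_ (sum_bernoulliRes_eq hp2 hB) hγ hγs, thetaQuot_eq_qPoch hb]
  · have key := eisensteinPart_add_sub_of_lt h₁ h₂ h₃ hN τ
    simp only [Fin.sum_univ_four, Matrix.cons_val]
    rw [natCast_sub_zmod hN.le, eisensteinPart_neg (natCast_ne_zero_of_lt (by lia) hN)]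
    simp only [qPoch, List.flatMap_cons, List.flatMap_nil, List.cons_append, List.nil_append,
      List.append_nil, List.map_cons, List.map_nil, List.prod_cons, List.prod_nil]
    simp only [qBracket] at key
    linear_combination key
  · intro i
    refine natCast_ne_zero_of_lt ?_ ?_ <;> fin_cases i <;> simp <;> lia

end EisensteinTheta

end

theorem mainTheorem5 :
    (DiamondEq 5 1 (thetaQuot 5 ![2, -3]) ∧
      ∀ τ : ℍ, thetaQuot 5 ![2, -3] τ =
        qPoch 1 [1] τ ^ 2 / qPoch 5 [1, 4] τ ^ 5) ∧
    (DiamondEq 5 2 (thetaQuot 5 ![-3, 2]) ∧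
      ∀ τ : ℍ, thetaQuot 5 ![-3, 2] τ =
        nome τ * qPoch 1 [1] τ ^ 2 / qPoch 5 [2, 3] τ ^ 5) ∧
    (DiamondEq 7 1 (thetaQuot 7 ![1, 0, -2]) ∧
      ∀ τ : ℍ, thetaQuot 7 ![1, 0, -2] τ =
        qPoch 7 [3, 4, 7, 7] τ / qPoch 7 [1, 6] τ ^ 2) ∧
    (DiamondEq 7 2 (thetaQuot 7 ![-2, 1, 0]) ∧
      ∀ τ : ℍ, thetaQuot 7 ![-2, 1, 0] τ =
        nome τ * qPoch 7 [2, 5, 7, 7] τ / qPoch 7 [3, 4] τ ^ 2) ∧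
    (DiamondEq 7 3 (thetaQuot 7 ![0, -2, 1]) ∧
      ∀ τ : ℍ, thetaQuot 7 ![0, -2, 1] τ =
        nome τ * qPoch 7 [1, 6, 7, 7] τ / qPoch 7 [2, 5] τ ^ 2) ∧
    (DiamondEq 11 1 (thetaQuot 11 ![0, 1, 0, -1, -1]) ∧
      ∀ τ : ℍ, thetaQuot 11 ![0, 1, 0, -1, -1] τ =
        qPoch 11 [4, 7, 11, 11] τ / qPoch 11 [1, 10, 2, 9] τ) ∧
    (DiamondEq 11 2 (thetaQuot 11 ![-1, 0, 0, 1, -1]) ∧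
      ∀ τ : ℍ, thetaQuot 11 ![-1, 0, 0, 1, -1] τ =
        nome τ * qPoch 11 [2, 9, 11, 11] τ / qPoch 11 [1, 10, 5, 6] τ) ∧
    (DiamondEq 11 3 (thetaQuot 11 ![1, -1, -1, 0, 0]) ∧
      ∀ τ : ℍ, thetaQuot 11 ![1, -1, -1, 0, 0] τ =
        nome τ * qPoch 11 [5, 6, 11, 11] τ / qPoch 11 [3, 8, 4, 7] τ) ∧
    (DiamondEq 11 5 (thetaQuot 11 ![0, -1, 1, -1, 0]) ∧
      ∀ τ : ℍ, thetaQuot 11 ![0, -1, 1, -1, 0] τ =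
        nome τ * qPoch 11 [3, 8, 11, 11] τ / qPoch 11 [2, 9, 4, 7] τ) ∧
    (DiamondEq 11 7 (thetaQuot 11 ![-1, 0, -1, 0, 1]) ∧
      ∀ τ : ℍ, thetaQuot 11 ![-1, 0, -1, 0, 1] τ =
        nome τ ^ 2 * qPoch 11 [1, 10, 11, 11] τ / qPoch 11 [3, 8, 5, 6] τ) ∧
    (DiamondEq 13 1 (thetaQuot 13 ![1, 0, 0, -1, 0, -1]) ∧
      ∀ τ : ℍ, thetaQuot 13 ![1, 0, 0, -1, 0, -1] τ =
        qPoch 13 [6, 7, 13, 13] τ / qPoch 13 [1, 12, 3, 10] τ) ∧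
    (DiamondEq 13 2 (thetaQuot 13 ![-1, -1, 0, 1, 0, 0]) ∧
      ∀ τ : ℍ, thetaQuot 13 ![-1, -1, 0, 1, 0, 0] τ =
        nome τ ^ 2 * qPoch 13 [3, 10, 13, 13] τ / qPoch 13 [5, 8, 6, 7] τ) ∧
    (DiamondEq 13 3 (thetaQuot 13 ![0, 0, -1, 0, 1, -1]) ∧
      ∀ τ : ℍ, thetaQuot 13 ![0, 0, -1, 0, 1, -1] τ =
        nome τ * qPoch 13 [2, 11, 13, 13] τ / qPoch 13 [1, 12, 4, 9] τ) ∧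
    (DiamondEq 13 4 (thetaQuot 13 ![0, 1, -1, -1, 0, 0]) ∧
      ∀ τ : ℍ, thetaQuot 13 ![0, 1, -1, -1, 0, 0] τ =
        nome τ * qPoch 13 [5, 8, 13, 13] τ / qPoch 13 [3, 10, 4, 9] τ) ∧
    (DiamondEq 13 5 (thetaQuot 13 ![0, -1, 1, 0, -1, 0]) ∧
      ∀ τ : ℍ, thetaQuot 13 ![0, -1, 1, 0, -1, 0] τ =
        nome τ * qPoch 13 [4, 9, 13, 13] τ / qPoch 13 [2, 11, 5, 8] τ) ∧
    (DiamondEq 13 7 (thetaQuot 13 ![-1, 0, 0, 0, -1, 1]) ∧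
      ∀ τ : ℍ, thetaQuot 13 ![-1, 0, 0, 0, -1, 1] τ =
        nome τ ^ 2 * qPoch 13 [1, 12, 13, 13] τ / qPoch 13 [2, 11, 6, 7] τ) ∧
    (DiamondEq 17 1 (thetaQuot 17 ![1, 0, 0, 0, 0, -1, -1, 0]) ∧
      ∀ τ : ℍ, thetaQuot 17 ![1, 0, 0, 0, 0, -1, -1, 0] τ =
        qPoch 17 [8, 9, 17, 17] τ / qPoch 17 [2, 15, 3, 14] τ) ∧
    (DiamondEq 17 2 (thetaQuot 17 ![0, -1, 0, 0, 1, 0, 0, -1]) ∧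
      ∀ τ : ℍ, thetaQuot 17 ![0, -1, 0, 0, 1, 0, 0, -1] τ =
        nome τ * qPoch 17 [4, 13, 17, 17] τ / qPoch 17 [1, 16, 7, 10] τ) ∧
    (DiamondEq 17 3 (thetaQuot 17 ![0, 0, 0, -1, 0, 1, 0, -1]) ∧
      ∀ τ : ℍ, thetaQuot 17 ![0, 0, 0, -1, 0, 1, 0, -1] τ =
        nome τ * qPoch 17 [3, 14, 17, 17] τ / qPoch 17 [1, 16, 5, 12] τ) ∧
    (DiamondEq 17 5 (thetaQuot 17 ![0, 0, 0, 1, -1, -1, 0, 0]) ∧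
      ∀ τ : ℍ, thetaQuot 17 ![0, 0, 0, 1, -1, -1, 0, 0] τ =
        nome τ * qPoch 17 [5, 12, 17, 17] τ / qPoch 17 [3, 14, 4, 13] τ) ∧
    (DiamondEq 17 7 (thetaQuot 17 ![0, -1, 1, 0, 0, 0, -1, 0]) ∧
      ∀ τ : ℍ, thetaQuot 17 ![0, -1, 1, 0, 0, 0, -1, 0] τ =
        nome τ * qPoch 17 [6, 11, 17, 17] τ / qPoch 17 [2, 15, 7, 10] τ) ∧
    (DiamondEq 17 8 (thetaQuot 17 ![0, 0, -1, 0, -1, 0, 0, 1]) ∧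
      ∀ τ : ℍ, thetaQuot 17 ![0, 0, -1, 0, -1, 0, 0, 1] τ =
        nome τ ^ 3 * qPoch 17 [1, 16, 17, 17] τ / qPoch 17 [4, 13, 6, 11] τ) ∧
    (DiamondEq 17 11 (thetaQuot 17 ![-1, 1, -1, 0, 0, 0, 0, 0]) ∧
      ∀ τ : ℍ, thetaQuot 17 ![-1, 1, -1, 0, 0, 0, 0, 0] τ =
        nome τ ^ 2 * qPoch 17 [7, 10, 17, 17] τ / qPoch 17 [6, 11, 8, 9] τ) ∧
    (DiamondEq 17 13 (thetaQuot 17 ![-1, 0, 0, -1, 0, 0, 1, 0]) ∧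
      ∀ τ : ℍ, thetaQuot 17 ![-1, 0, 0, -1, 0, 0, 1, 0] τ =
        nome τ ^ 3 * qPoch 17 [2, 15, 17, 17] τ / qPoch 17 [5, 12, 8, 9] τ) ∧
    (DiamondEq 19 1 (thetaQuot 19 ![1, 1, 0, 0, -1, -1, -1, 0, 0]) ∧
      ∀ τ : ℍ, thetaQuot 19 ![1, 1, 0, 0, -1, -1, -1, 0, 0] τ =
        qPoch 19 [8, 11, 9, 10, 19, 19] τ / qPoch 19 [3, 16, 4, 15, 5, 14] τ) ∧
    (DiamondEq 19 2 (thetaQuot 19 ![0, -1, -1, 0, 1, 1, 0, -1, 0]) ∧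
      ∀ τ : ℍ, thetaQuot 19 ![0, -1, -1, 0, 1, 1, 0, -1, 0] τ =
        nome τ ^ 2 * qPoch 19 [4, 15, 5, 14, 19, 19] τ / qPoch 19 [2, 17, 7, 12, 8, 11] τ) ∧
    (DiamondEq 19 3 (thetaQuot 19 ![1, -1, 0, 0, -1, 0, 1, 0, -1]) ∧
      ∀ τ : ℍ, thetaQuot 19 ![1, -1, 0, 0, -1, 0, 1, 0, -1] τ =
        nome τ * qPoch 19 [3, 16, 9, 10, 19, 19] τ / qPoch 19 [1, 18, 5, 14, 8, 11] τ) ∧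
    (DiamondEq 19 4 (thetaQuot 19 ![0, 0, 1, -1, 0, -1, 0, 1, -1]) ∧
      ∀ τ : ℍ, thetaQuot 19 ![0, 0, 1, -1, 0, -1, 0, 1, -1] τ =
        nome τ * qPoch 19 [2, 17, 7, 12, 19, 19] τ / qPoch 19 [1, 18, 4, 15, 6, 13] τ) ∧
    (DiamondEq 19 5 (thetaQuot 19 ![0, 0, -1, 1, 0, 0, -1, 1, -1]) ∧
      ∀ τ : ℍ, thetaQuot 19 ![0, 0, -1, 1, 0, 0, -1, 1, -1] τ =
        nome τ * qPoch 19 [2, 17, 6, 13, 19, 19] τ / qPoch 19 [1, 18, 3, 16, 7, 12] τ) ∧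
    (DiamondEq 19 7 (thetaQuot 19 ![0, 0, 1, -1, -1, 1, 0, -1, 0]) ∧
      ∀ τ : ℍ, thetaQuot 19 ![0, 0, 1, -1, -1, 1, 0, -1, 0] τ =
        nome τ * qPoch 19 [4, 15, 7, 12, 19, 19] τ / qPoch 19 [2, 17, 5, 14, 6, 13] τ) ∧
    (DiamondEq 19 9 (thetaQuot 19 ![-1, -1, 0, -1, 0, 0, 1, 0, 1]) ∧
      ∀ τ : ℍ, thetaQuot 19 ![-1, -1, 0, -1, 0, 0, 1, 0, 1] τ =
        nome τ ^ 5 * qPoch 19 [1, 18, 3, 16, 19, 19] τ / qPoch 19 [6, 13, 8, 11, 9, 10] τ) ∧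
    (DiamondEq 19 11 (thetaQuot 19 ![-1, 0, 0, 1, 0, 0, -1, -1, 1]) ∧
      ∀ τ : ℍ, thetaQuot 19 ![-1, 0, 0, 1, 0, 0, -1, -1, 1] τ =
        nome τ ^ 2 * qPoch 19 [1, 18, 6, 13, 19, 19] τ / qPoch 19 [2, 17, 3, 16, 9, 10] τ) ∧
    (DiamondEq 19 13 (thetaQuot 19 ![-1, 1, -1, 0, 1, -1, 0, 0, 0]) ∧
      ∀ τ : ℍ, thetaQuot 19 ![-1, 1, -1, 0, 1, -1, 0, 0, 0] τ =
        nome τ ^ 2 * qPoch 19 [5, 14, 8, 11, 19, 19] τ / qPoch 19 [4, 15, 7, 12, 9, 10] τ) := by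
  -- For each translate, the first line gives the residues `b₁, b₂, b₃` of the four-term relation;
  -- the second gives the exponents `n` of the factors `(q^n, q^{p-n}; q^p)_∞`.
  have : Fact (Nat.Prime 5) := ⟨by norm_num⟩
  have : Fact (Nat.Prime 7) := ⟨by norm_num⟩
  have : Fact (Nat.Prime 11) := ⟨by norm_num⟩
  have : Fact (Nat.Prime 13) := ⟨by norm_num⟩
  have : Fact (Nat.Prime 17) := ⟨by norm_num⟩
  have : Fact (Nat.Prime 19) := ⟨by norm_num⟩
  refine ⟨⟨?_, fun τ ↦ ?_⟩, ⟨?_, fun τ ↦ ?_⟩, ⟨?_, fun τ ↦ ?_⟩, ⟨?_, fun τ ↦ ?_⟩, ⟨?_, fun τ ↦ ?_⟩,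
    ⟨?_, fun τ ↦ ?_⟩, ⟨?_, fun τ ↦ ?_⟩, ⟨?_, fun τ ↦ ?_⟩, ⟨?_, fun τ ↦ ?_⟩, ⟨?_, fun τ ↦ ?_⟩,
    ⟨?_, fun τ ↦ ?_⟩, ⟨?_, fun τ ↦ ?_⟩, ⟨?_, fun τ ↦ ?_⟩, ⟨?_, fun τ ↦ ?_⟩, ⟨?_, fun τ ↦ ?_⟩,
    ⟨?_, fun τ ↦ ?_⟩, ⟨?_, fun τ ↦ ?_⟩, ⟨?_, fun τ ↦ ?_⟩, ⟨?_, fun τ ↦ ?_⟩, ⟨?_, fun τ ↦ ?_⟩,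
    ⟨?_, fun τ ↦ ?_⟩, ⟨?_, fun τ ↦ ?_⟩, ⟨?_, fun τ ↦ ?_⟩, ⟨?_, fun τ ↦ ?_⟩, ⟨?_, fun τ ↦ ?_⟩,
    ⟨?_, fun τ ↦ ?_⟩, ⟨?_, fun τ ↦ ?_⟩, ⟨?_, fun τ ↦ ?_⟩, ⟨?_, fun τ ↦ ?_⟩, ⟨?_, fun τ ↦ ?_⟩,
    ⟨?_, fun τ ↦ ?_⟩, ⟨?_, fun τ ↦ ?_⟩, ⟨?_, fun τ ↦ ?_⟩⟩
  · exact diamondEq_thetaQuot_of_lt 1 1 1 (by decide) (by decide)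
  · rw [thetaQuot_eq_qPoch (m := 0) (N := [1, 1, 2, 2]) (D := [1, 1, 1, 1, 1]) (by decide),
      qPoch_one_eq_qPoch_five]
    simp [qPoch]
    ring
  · exact diamondEq_thetaQuot_of_eq_add 2 2 2 (m := 1) (by decide) (by decide)
  · rw [thetaQuot_eq_qPoch (m := 1) (N := [1, 1, 2, 2]) (D := [2, 2, 2, 2, 2]) (by decide),
      qPoch_one_eq_qPoch_five]
    simp [qPoch]
    ring
  · exact diamondEq_thetaQuot_of_lt 1 1 2 (by decide) (by decide)
  · rw [thetaQuot_eq_qPoch (m := 0) (N := [3]) (D := [1, 1]) (by decide)]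
    simp [qPoch]
    ring
  · exact diamondEq_thetaQuot_of_eq_add 2 3 3 (m := 1) (by decide) (by decide)
  · rw [thetaQuot_eq_qPoch (m := 1) (N := [2]) (D := [3, 3]) (by decide)]
    simp [qPoch]
    ring
  · exact diamondEq_thetaQuot_of_eq_add 2 2 4 (m := 1) (by decide) (by decide)
  · rw [thetaQuot_eq_qPoch (m := 1) (N := [1]) (D := [2, 2]) (by decide)]
    simp [qPoch]
    ring
  · exact diamondEq_thetaQuot_of_lt 1 2 3 (by decide) (by decide)
  · simpa using thetaQuot_eq_qPoch (m := 0) (N := [4]) (D := [1, 2]) (by decide) τ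
  · exact diamondEq_thetaQuot_of_eq_add 3 4 5 (m := 1) (by decide) (by decide)
  · simpa using thetaQuot_eq_qPoch (m := 1) (N := [2]) (D := [1, 5]) (by decide) τ
  · exact diamondEq_thetaQuot_of_eq_add 2 3 7 (m := 1) (by decide) (by decide)
  · simpa using thetaQuot_eq_qPoch (m := 1) (N := [5]) (D := [3, 4]) (by decide) τ
  · exact diamondEq_thetaQuot_of_eq_add 2 4 6 (m := 1) (by decide) (by decide)
  · simpa using thetaQuot_eq_qPoch (m := 1) (N := [3]) (D := [2, 4]) (by decide) τ
  · exact diamondEq_thetaQuot_of_eq_add 3 4 6 (m := 2) (by decide) (by decide)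
  · simpa using thetaQuot_eq_qPoch (m := 2) (N := [1]) (D := [3, 5]) (by decide) τ
  · exact diamondEq_thetaQuot_of_lt 1 3 4 (by decide) (by decide)
  · simpa using thetaQuot_eq_qPoch (m := 0) (N := [6]) (D := [1, 3]) (by decide) τ
  · exact diamondEq_thetaQuot_of_eq_add 4 5 6 (m := 2) (by decide) (by decide)
  · simpa using thetaQuot_eq_qPoch (m := 2) (N := [3]) (D := [5, 6]) (by decide) τ
  · exact diamondEq_thetaQuot_of_eq_add 3 4 7 (m := 1) (by decide) (by decide)
  · simpa using thetaQuot_eq_qPoch (m := 1) (N := [2]) (D := [1, 4]) (by decide) τ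
  · exact diamondEq_thetaQuot_of_eq_add 2 3 9 (m := 1) (by decide) (by decide)
  · simpa using thetaQuot_eq_qPoch (m := 1) (N := [5]) (D := [3, 4]) (by decide) τ
  · exact diamondEq_thetaQuot_of_eq_add 2 5 7 (m := 1) (by decide) (by decide)
  · simpa using thetaQuot_eq_qPoch (m := 1) (N := [4]) (D := [2, 5]) (by decide) τ
  · exact diamondEq_thetaQuot_of_eq_add 3 5 7 (m := 2) (by decide) (by decide)
  · simpa using thetaQuot_eq_qPoch (m := 2) (N := [1]) (D := [2, 6]) (by decide) τ
  · exact diamondEq_thetaQuot_of_lt 2 3 5 (by decide) (by decide)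
  · simpa using thetaQuot_eq_qPoch (m := 0) (N := [8]) (D := [2, 3]) (by decide) τ
  · exact diamondEq_thetaQuot_of_eq_add 5 6 7 (m := 1) (by decide) (by decide)
  · simpa using thetaQuot_eq_qPoch (m := 1) (N := [4]) (D := [1, 7]) (by decide) τ
  · exact diamondEq_thetaQuot_of_eq_add 4 5 9 (m := 1) (by decide) (by decide)
  · simpa using thetaQuot_eq_qPoch (m := 1) (N := [3]) (D := [1, 5]) (by decide) τ
  · exact diamondEq_thetaQuot_of_eq_add 2 3 13 (m := 1) (by decide) (by decide)
  · simpa using thetaQuot_eq_qPoch (m := 1) (N := [5]) (D := [3, 4]) (by decide) τ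
  · exact diamondEq_thetaQuot_of_eq_add 2 7 9 (m := 1) (by decide) (by decide)
  · simpa using thetaQuot_eq_qPoch (m := 1) (N := [6]) (D := [2, 7]) (by decide) τ
  · exact diamondEq_thetaQuot_of_eq_add 4 6 10 (m := 3) (by decide) (by decide)
  · simpa using thetaQuot_eq_qPoch (m := 3) (N := [1]) (D := [4, 6]) (by decide) τ
  · exact diamondEq_thetaQuot_of_eq_add 4 6 9 (m := 2) (by decide) (by decide)
  · simpa using thetaQuot_eq_qPoch (m := 2) (N := [7]) (D := [6, 8]) (by decide) τ
  · exact diamondEq_thetaQuot_of_eq_add 5 6 9 (m := 3) (by decide) (by decide)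
  · simpa using thetaQuot_eq_qPoch (m := 3) (N := [2]) (D := [5, 8]) (by decide) τ
  · exact diamondEq_thetaQuot_of_lt 3 4 5 (by decide) (by decide)
  · simpa using thetaQuot_eq_qPoch (m := 0) (N := [8, 9]) (D := [3, 4, 5]) (by decide) τ
  · exact diamondEq_thetaQuot_of_eq_add 6 7 8 (m := 2) (by decide) (by decide)
  · simpa using thetaQuot_eq_qPoch (m := 2) (N := [4, 5]) (D := [2, 7, 8]) (by decide) τ
  · exact diamondEq_thetaQuot_of_eq_add 4 5 11 (m := 1) (by decide) (by decide)
  · simpa using thetaQuot_eq_qPoch (m := 1) (N := [3, 9]) (D := [1, 5, 8]) (by decide) τ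
  · exact diamondEq_thetaQuot_of_eq_add 3 4 13 (m := 1) (by decide) (by decide)
  · simpa using thetaQuot_eq_qPoch (m := 1) (N := [2, 7]) (D := [1, 4, 6]) (by decide) τ
  · exact diamondEq_thetaQuot_of_eq_add 3 7 10 (m := 1) (by decide) (by decide)
  · simpa using thetaQuot_eq_qPoch (m := 1) (N := [2, 6]) (D := [1, 3, 7]) (by decide) τ
  · exact diamondEq_thetaQuot_of_eq_add 2 5 13 (m := 1) (by decide) (by decide)
  · simpa using thetaQuot_eq_qPoch (m := 1) (N := [4, 7]) (D := [2, 5, 6]) (by decide) τ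
  · exact diamondEq_thetaQuot_of_eq_add 6 8 10 (m := 5) (by decide) (by decide)
  · simpa using thetaQuot_eq_qPoch (m := 5) (N := [1, 3]) (D := [6, 8, 9]) (by decide) τ
  · exact diamondEq_thetaQuot_of_eq_add 3 8 10 (m := 2) (by decide) (by decide)
  · simpa using thetaQuot_eq_qPoch (m := 2) (N := [1, 6]) (D := [2, 3, 9]) (by decide) τ
  · exact diamondEq_thetaQuot_of_eq_add 4 7 10 (m := 2) (by decide) (by decide)
  · simpa using thetaQuot_eq_qPoch (m := 2) (N := [5, 8]) (D := [4, 7, 9]) (by decide) τ
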